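/- **Setting.** Let $q_0>0$ and $q_\pm\in\mathbb C$ with $|q_\pm|=q_0$. Let $q:\mathbb R^2\to\mathbb C$ be a classical solution ($C^2$ in $x$, $C^1$ in $t$) of $$i q_t+\tfrac12 q_{xx}+(|q|^2-q_0^2)q=0$$ (the form to which the focusing Kundu–Eckhaus equation is reduced by a gauge transformation), with $q\to q_\pm$ and $q_x\to0$ as $x\to\pm\infty$, locally uniformly in $t$, and $q(\cdot,t)-q_\pm\in L^1(\mathbb R^\pm)$ for every $t$. For $z\in\mathbb C\setminus\{0\}$ put $k=\frac12(z-q_0^2/z)$, $\lambda=\frac12(z+q_0^2/z)$, $\theta=\lambda(x+kt)$, $\sigma_3=\mathrm{diag}(1,-1)$, $Q=\begin{pmatrix}0&q\\-q^*&0\end{pmatrix}$, $Q_\pm=\begin{pmatrix}0&q_\pm\\-q_\pm^*&0\end{pmatrix}$, and consider the Lax pair $$\psi_x=X\psi,\quad X=-ik\sigma_3+Q,\qquad \psi_t=T\psi,\quad T=-ik^2\sigma_3+kQ+\tfrac i2\sigma_3Q_x-\tfrac i2(Q^2+q_0^2)\sigma_3 .$$ Let $D^{\pm}=\{z:\pm(|z|^2-q_0^2)\,\mathrm{Im}\,z>0\}$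 and $\Sigma=\mathbb R\cup\{|z|=q_0\}$. Let $\psi_{+,1},\psi_{-,2}$ (for $z\in D^-$) and $\psi_{-,1},\psi_{+,2}$ (for $z\in D^+$) be the Jost functions: $\psi_{\pm,j}(x,t;z)$ is the simultaneous solution of the Lax pair such that, for every $t$, $\psi_{\pm,1}e^{i\theta}$, respectively $\psi_{\pm,2}e^{-i\theta}$, tends as $x\to\pm\infty$ to the first, respectively second, column of $I-\frac iz\sigma_3Q_\pm$. With $\gamma=1+q_0^2/z^2$ let $$s_{11}=\mathrm{Wr}(\psi_{+,1},\psi_{-,2})/\gamma\ \text{ on } D^-,\qquad s_{22}=\mathrm{Wr}(\psi_{-,1},\psi_{+,2})/\gamma\ \text{ on } D^+ .$$ The discrete spectrum at time $t$ is the set of $z\in\mathbb C\setminus\Sigma$ for which $\varphi_x=X(\cdot,t;z)\varphi$ has a non-trivial solution in $L^2(\mathbb R)$. At a zero $z\in D^-$ of $s_{11}$ let $b_-(z)$ be the constant, independent of $x$ and $t$, with $\psi_{+,1}(z)=b_-(z)\psi_{-,2}(z)$, and let $C_-[z]=b_-(z)/s_{11}'(z)$; at a zero $z\in D^+$ of $s_{22}$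 let $b_+(z)$ be the constant with $\psi_{+,2}(z)=b_+(z)\psi_{-,1}(z)$, and let $C_+[z]=b_+(z)/s_{22}'(z)$. **Statement.** Suppose that $s_{11}$ has exactly $N$ zeros $z_1,\dots,z_N$ (distinct) in $D^-\cap\{\mathrm{Im}\,z<0\}$ and that all are simple, $s_{11}'(z_n)\ne0$. Then the following hold. 1. The Jost functions above exist and are unique, and the Wronskians do not depend on $x,t$. 2. For every $t$ the discrete spectrum is $\mathbb Z=\{z_n,\,-q_0^2/z_n^*,\,z_n^*,\,-q_0^2/z_n\}_{n=1}^N$. The zeros of $s_{11}$ in $D^-$ are exactly the points $z_n,\,-q_0^2/z_n^*$, the zeros of $s_{22}$ in $D^+$ are exactly the points $z_n^*,\,-q_0^2/z_n$, and at each of them the derivative of $s_{11}$, respectively $s_{22}$, is non-zero. 3. The constants $b_\pm$ at these points exist and are unique, and for every $z\in\mathbb Z\cap D^-$ $$C_-[z]=-C_+^*[z^*]=\frac{z^2}{q_-^2}\,C_+\!\left[-\frac{q_0^2}{z}\right]=-\frac{z^2}{q_-^2}\,C_-^*\!\left[-\frac{q_0^2}{z^*}\right].$$ Here $^*$ is complex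 conjugation. -/

import Mathlib

open scoped ComplexConjugate
open Filter Topology MeasureTheory Complex

noncomputable section

namespace KE

/-! The scattering problem.  The potential is `q x t`, with boundary values `qm` (as `x → -∞`) and
`qp` (as `x → +∞`) of modulus `q0`; `z` is the uniformization variable. -/

/-- `k(z) = (z - q0² / z) / 2`. -/
def kOf (q0 : ℝ) (z : ℂ) : ℂ := (z - (q0 : ℂ) ^ 2 / z) / 2

/-- `λ(z) = (z + q0² / z) / 2`. -/
def lamOf (q0 : ℝ) (z : ℂ) : ℂ := (z + (q0 : ℂ) ^ 2 / z) / 2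

/-- `θ(x,t;z) = λ(z) (x + k(z) t)`. -/
def theta (q0 : ℝ) (z : ℂ) (x t : ℝ) : ℂ := lamOf q0 z * ((x : ℂ) + kOf q0 z * (t : ℂ))

/-- The region `D⁺`, where `Im λ > 0`. -/
def DPlus (q0 : ℝ) : Set ℂ := {z | 0 < (‖z‖ ^ 2 - q0 ^ 2) * z.im}

/-- The region `D⁻`, where `Im λ < 0`. -/
def DMinus (q0 : ℝ) : Set ℂ := {z | (‖z‖ ^ 2 - q0 ^ 2) * z.im < 0}

/-- The contour `Σ`, the real line together with the circle of radius `q0` (where `λ` is real,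
with `z = 0` included). -/
def contour (q0 : ℝ) : Set ℂ := {z | z.im = 0 ∨ ‖z‖ = q0}

/-- The Pauli matrix `σ₃`. -/
def sigma3 : Matrix (Fin 2) (Fin 2) ℂ := !![1, 0; 0, -1]

/-- The matrix with off-diagonal entries `u` and `-u*`. -/
def potMat (u : ℂ) : Matrix (Fin 2) (Fin 2) ℂ := !![0, u; -conj u, 0]

/-- The matrix `X = -i k σ₃ + Q` of the spatial part of the Lax pair. -/
def laxX (q0 : ℝ) (q : ℝ → ℝ → ℂ) (z : ℂ) (x t : ℝ) : Matrix (Fin 2) (Fin 2) ℂ :=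
  -(I * kOf q0 z) • sigma3 + potMat (q x t)

/-- The matrix `T = -i k² σ₃ + k Q + (i/2) σ₃ Q_x - (i/2) (Q² + q0²) σ₃` of the temporal part
of the Lax pair. -/
def laxT (q0 : ℝ) (q : ℝ → ℝ → ℂ) (z : ℂ) (x t : ℝ) : Matrix (Fin 2) (Fin 2) ℂ :=
  -(I * kOf q0 z ^ 2) • sigma3 + kOf q0 z • potMat (q x t)
    + (I / 2) • (sigma3 * potMat (deriv (fun y => q y t) x))
    - (I / 2) • ((potMat (q x t) ^ 2 + (q0 : ℂ) ^ 2 • (1 : Matrix (Fin 2) (Fin 2) ℂ)) * sigma3)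

/-- The eigenvector matrix `Y_±(z) = 1 - (i/z) σ₃ Q_±` of the asymptotic problem. -/
def eigY (qb : ℂ) (z : ℂ) : Matrix (Fin 2) (Fin 2) ℂ := 1 - (I / z) • (sigma3 * potMat qb)

/-- `γ(z) = det Y_±(z) = 1 + q0² / z²`. -/
def gam (q0 : ℝ) (z : ℂ) : ℂ := 1 + (q0 : ℂ) ^ 2 / z ^ 2

/-- Classical solutions (of class `C²` in `x` and `C¹` in `t`) of
`i q_t + q_xx / 2 + (|q|² - q0²) q = 0`, the compatibility condition of the Lax pair, with
non-zero boundary conditions: `q → q_±` and `q_x → 0` as `x → ±∞`, locally uniformly in `t`, and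
`q(·,t) - q_±` is integrable on the half-line `ℝ^±` for every `t`. -/
structure IsPotential (q0 : ℝ) (qm qp : ℂ) (q : ℝ → ℝ → ℂ) : Prop where
  q0_pos : 0 < q0
  norm_qm : ‖qm‖ = q0
  norm_qp : ‖qp‖ = q0
  contDiff_x : ∀ t, ContDiff ℝ 2 (fun x => q x t)
  contDiff_t : ∀ x, ContDiff ℝ 1 (fun t => q x t)
  continuous_q : Continuous (fun p : ℝ × ℝ => q p.1 p.2)
  continuous_qx : Continuous (fun p : ℝ × ℝ => deriv (fun y => q y p.2) p.1)
  continuous_qxx : Continuous (fun p : ℝ × ℝ => iteratedDeriv 2 (fun y => q y p.2) p.1)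
  continuous_qt : Continuous (fun p : ℝ × ℝ => deriv (fun s => q p.1 s) p.2)
  equation : ∀ x t, I * deriv (fun s => q x s) t + iteratedDeriv 2 (fun y => q y t) x / 2
    + ((‖q x t‖ : ℂ) ^ 2 - (q0 : ℂ) ^ 2) * q x t = 0
  tendsto_qp : ∀ t, Tendsto (fun p : ℝ × ℝ => q p.1 p.2) (atTop ×ˢ 𝓝 t) (𝓝 qp)
  tendsto_qm : ∀ t, Tendsto (fun p : ℝ × ℝ => q p.1 p.2) (atBot ×ˢ 𝓝 t) (𝓝 qm)
  tendsto_qx_top : ∀ t,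
    Tendsto (fun p : ℝ × ℝ => deriv (fun y => q y p.2) p.1) (atTop ×ˢ 𝓝 t) (𝓝 0)
  tendsto_qx_bot : ∀ t,
    Tendsto (fun p : ℝ × ℝ => deriv (fun y => q y p.2) p.1) (atBot ×ˢ 𝓝 t) (𝓝 0)
  integrable_qp : ∀ t, IntegrableOn (fun x => q x t - qp) (Set.Ici 0)
  integrable_qm : ∀ t, IntegrableOn (fun x => q x t - qm) (Set.Iic 0)

/-- `ψ` is the `j`-th column (`j = 0, 1`) of a Jost function: a simultaneous solution of both
equations of the Lax pair, such that `ψ e^{iθσ₃}` tends to the `j`-th column of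
`1 - (i/z) σ₃ Q_b` at the end `l` (`atTop` or `atBot`) of the `x`-axis. -/
structure IsJostColumn (q0 : ℝ) (q : ℝ → ℝ → ℂ) (l : Filter ℝ) (qb : ℂ) (j : Fin 2) (z : ℂ)
    (ψ : ℝ → ℝ → Fin 2 → ℂ) : Prop where
  eq_x : ∀ x t, HasDerivAt (fun y => ψ y t) ((laxX q0 q z x t).mulVec (ψ x t)) x
  eq_t : ∀ x t, HasDerivAt (fun s => ψ x s) ((laxT q0 q z x t).mulVec (ψ x t)) t
  asymptotic : ∀ t, Tendsto (fun x => exp (I * theta q0 z x t * sigma3 j j) • ψ x t) l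
    (𝓝 (fun i => eigY qb z i j))

/-- The column `ψ_{+,j}(x,t;z)`, normalized as `x → +∞`. -/
def jostPlus (q0 : ℝ) (q : ℝ → ℝ → ℂ) (qp : ℂ) (j : Fin 2) (z : ℂ) : ℝ → ℝ → Fin 2 → ℂ :=
  Classical.epsilon (IsJostColumn q0 q atTop qp j z)

/-- The column `ψ_{-,j}(x,t;z)`, normalized as `x → -∞`. -/
def jostMinus (q0 : ℝ) (q : ℝ → ℝ → ℂ) (qm : ℂ) (j : Fin 2) (z : ℂ) : ℝ → ℝ → Fin 2 → ℂ :=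
  Classical.epsilon (IsJostColumn q0 q atBot qm j z)

/-- `Wr(u, v) = det (u, v)`. -/
def wronskian (u v : Fin 2 → ℂ) : ℂ := u 0 * v 1 - u 1 * v 0

/-- `s₁₁ = Wr(ψ_{+,1}, ψ_{-,2}) / γ`, for `z ∈ D⁻`.  (The Wronskian does not depend on `x`, `t`;
it is taken at the origin.) -/
def s11 (q0 : ℝ) (q : ℝ → ℝ → ℂ) (qm qp : ℂ) (z : ℂ) : ℂ :=
  wronskian (jostPlus q0 q qp 0 z 0 0) (jostMinus q0 q qm 1 z 0 0) / gam q0 z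

/-- `s₂₂ = Wr(ψ_{-,1}, ψ_{+,2}) / γ`, for `z ∈ D⁺`. -/
def s22 (q0 : ℝ) (q : ℝ → ℝ → ℂ) (qm qp : ℂ) (z : ℂ) : ℂ :=
  wronskian (jostMinus q0 q qm 0 z 0 0) (jostPlus q0 q qp 1 z 0 0) / gam q0 z

/-- The discrete spectrum of the scattering problem at time `t`, in the variable `z`: the points
off the contour for which `φ_x = X φ` has a non-trivial solution in `L²(ℝ)`. -/
def discreteSpectrum (q0 : ℝ) (q : ℝ → ℝ → ℂ) (t : ℝ) : Set ℂ :=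
  {z | z ∉ contour q0 ∧ ∃ φ : ℝ → Fin 2 → ℂ, φ ≠ 0 ∧
    (∀ x, HasDerivAt φ ((laxX q0 q z x t).mulVec (φ x)) x) ∧
    ∀ i, MemLp (fun x => φ x i) 2 volume}

/-- `b` is the constant `b_-(z)`: `ψ_{+,1}(x,t;z) = b ψ_{-,2}(x,t;z)` for all `x`, `t`. -/
def IsBMinus (q0 : ℝ) (q : ℝ → ℝ → ℂ) (qm qp : ℂ) (z b : ℂ) : Prop :=
  ∀ x t, jostPlus q0 q qp 0 z x t = b • jostMinus q0 q qm 1 z x t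

/-- `b` is the constant `b_+(z)`: `ψ_{+,2}(x,t;z) = b ψ_{-,1}(x,t;z)` for all `x`, `t`. -/
def IsBPlus (q0 : ℝ) (q : ℝ → ℝ → ℂ) (qm qp : ℂ) (z b : ℂ) : Prop :=
  ∀ x t, jostPlus q0 q qp 1 z x t = b • jostMinus q0 q qm 0 z x t

/-- `b_-(z)`. -/
def bMinus (q0 : ℝ) (q : ℝ → ℝ → ℂ) (qm qp : ℂ) (z : ℂ) : ℂ :=
  Classical.epsilon (IsBMinus q0 q qm qp z)

/-- `b_+(z)`. -/
def bPlus (q0 : ℝ) (q : ℝ → ℝ → ℂ) (qm qp : ℂ) (z : ℂ) : ℂ :=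
  Classical.epsilon (IsBPlus q0 q qm qp z)

/-- The norming constant `C_-[z] = b_-(z) / s₁₁'(z)`. -/
def CMinus (q0 : ℝ) (q : ℝ → ℝ → ℂ) (qm qp : ℂ) (z : ℂ) : ℂ :=
  bMinus q0 q qm qp z / deriv (s11 q0 q qm qp) z

/-- The norming constant `C_+[z] = b_+(z) / s₂₂'(z)`. -/
def CPlus (q0 : ℝ) (q : ℝ → ℝ → ℂ) (qm qp : ℂ) (z : ℂ) : ℂ :=
  bPlus q0 q qm qp z / deriv (s22 q0 q qm qp) z

end KE

end

/-! The only Jost column built by analysis is ψ_{+,1} on D⁻. There Im λ < 0, and at t = 0 the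
substitution ψ = e^{-iλx} Y₊ w turns ψ_x = Xψ into w' = diag(0, 2iλ) w + V w, with V integrable at
+∞ and Re(2iλ) > 0. Variation of constants from +∞ is then a contraction in a weighted sup norm, and
its fixed point tends to (1, 0) (`exists_solution_tendsto`). The zero curvature identity, which
encodes the equation for q, turns this solution into a simultaneous solution of the Lax pair
(`hasDerivAt_time_of_zero_curvature`). Its normalization persists in t because the first column of
Y₊ is an eigenvector of the limit of T (`tendsto_of_hasDerivAt_time`).

The other columns follow by symmetry. Replacing q by q*(-x,-t) exchanges the two ends of the line.
The map z ↦ -q₀²/z fixes k, and with it X and T, but negates λ, so it exchanges D⁺ with D⁻ and the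
two columns. Each column decays at its own end, which forces uniqueness (`IsJostColumn.unique`).
Uniqueness in turn makes the symmetries z ↦ z* and z ↦ -q₀²/z exact identities between Jost
functions, hence between s₁₁ and s₂₂, their derivatives, b_± and C_±.

X and T are traceless up to no error, so Wronskians of simultaneous solutions are constant. An L²
solution must have zero Wronskian with the decaying column at each end; it exists exactly when the
two decaying columns are proportional, that is, at a zero of s₁₁ or s₂₂
(`exists_memLp_iff_wronskian_eq_zero`). The symmetries then generate all zeros from those in the
lower half of D⁻.

Analyticity of s₁₁ is never needed: a non-zero `deriv` already contains differentiability at the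
zero, and the symmetries carry it to the rest of the quartet. -/

noncomputable section

namespace KE

/-! ### Grönwall estimates, linear differential equations, integrals over half-lines. -/

section Analysis

variable {E : Type*} [NormedAddCommGroup E] [NormedSpace ℝ E]

/-- From e^s - 1 ≤ s e^s. The cruder bound has no division by K, so K = 0 needs no separate
treatment later. -/
lemma gronwallBound_le {δ K ε r : ℝ} (hK : 0 ≤ K) (hε : 0 ≤ ε) :
    gronwallBound δ K ε r ≤ (δ + ε * r) * Real.exp (K * r) := by
  rcases hK.eq_or_lt with rfl | hK
  · simp [gronwallBound_K0]
  · rw [gronwallBound_of_K_ne_0 hK.ne']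
    have h1 : 1 - K * r ≤ Real.exp (-(K * r)) := Real.one_sub_le_exp_neg _
    have h2 : Real.exp (-(K * r)) * Real.exp (K * r) = 1 := by
      rw [← Real.exp_add]; simp
    have h3 : Real.exp (K * r) - 1 ≤ K * r * Real.exp (K * r) := by
      nlinarith [Real.exp_pos (K * r)]
    have h4 : ε / K * (Real.exp (K * r) - 1) ≤ ε / K * (K * r * Real.exp (K * r)) :=
      mul_le_mul_of_nonneg_left h3 (by positivity)
    have h5 : ε / K * (K * r * Real.exp (K * r)) = ε * r * Real.exp (K * r) := by
      field_simp
    simp only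
    linarith

/-- Grönwall's inequality on the interval between `a` and `b`, in either order. -/
lemma norm_le_of_norm_deriv_le {f f' : ℝ → E} {K ε a b : ℝ} (hK : 0 ≤ K) (hε : 0 ≤ ε)
    (hf : ∀ s ∈ Set.uIcc a b, HasDerivAt f (f' s) s)
    (bound : ∀ s ∈ Set.uIcc a b, ‖f' s‖ ≤ K * ‖f s‖ + ε) :
    ‖f b‖ ≤ (‖f a‖ + ε * |b - a|) * Real.exp (K * |b - a|) := by
  have key : ∀ (g g' : ℝ → E) (c d : ℝ), c ≤ d → (∀ s ∈ Set.Icc c d, HasDerivAt g (g' s) s) →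
      (∀ s ∈ Set.Icc c d, ‖g' s‖ ≤ K * ‖g s‖ + ε) →
      ‖g d‖ ≤ (‖g c‖ + ε * (d - c)) * Real.exp (K * (d - c)) := by
    intro g g' c d hcd hg hb
    refine (norm_le_gronwallBound_of_norm_deriv_right_le
      (fun s hs => (hg s hs).continuousAt.continuousWithinAt)
      (fun s hs => (hg s (Set.Ico_subset_Icc_self hs)).hasDerivWithinAt) le_rfl
      (fun s hs => hb s (Set.Ico_subset_Icc_self hs)) d ⟨hcd, le_rfl⟩).trans
      (gronwallBound_le hK hε)
  rcases le_total a b with hab | hab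
  · rw [Set.uIcc_of_le hab] at hf bound
    rw [abs_of_nonneg (sub_nonneg.2 hab)]
    exact key f f' a b hab hf bound
  · rw [Set.uIcc_of_ge hab] at hf bound
    rw [abs_of_nonpos (sub_nonpos.2 hab)]
    have hm : ∀ s ∈ Set.Icc (-a) (-b), -s ∈ Set.Icc b a := fun s hs =>
      ⟨by linarith [hs.2], by linarith [hs.1]⟩
    have := key (fun s => f (-s)) (fun s => -f' (-s)) (-a) (-b) (by linarith)
      (fun s hs => by
        simpa [Function.comp_def] using (hf (-s) (hm s hs)).scomp s (hasDerivAt_neg s))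
      (fun s hs => by simpa using bound (-s) (hm s hs))
    simp only [neg_neg] at this
    convert this using 3 <;> ring

/-- Two solutions of a linear equation with continuous coefficients that agree at one point
agree everywhere. -/
lemma linear_ode_unique {A : ℝ → E →L[ℝ] E} (hA : Continuous A) {f g : ℝ → E}
    (hf : ∀ x, HasDerivAt f (A x (f x)) x) (hg : ∀ x, HasDerivAt g (A x (g x)) x) {a : ℝ}
    (h : f a = g a) (b : ℝ) : f b = g b := by
  obtain ⟨K, hK⟩ := isCompact_uIcc.exists_bound_of_continuousOn (hA.continuousOn (s := Set.uIcc a b))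
  have := norm_le_of_norm_deriv_le (f := f - g) (f' := fun s => A s (f s) - A s (g s)) (K := |K|)
    (ε := 0) (a := a) (b := b) (abs_nonneg _) le_rfl (fun s _ => (hf s).sub (hg s))
    (fun s hs => by
      rw [← map_sub, add_zero]
      exact (A s).le_of_opNorm_le ((hK s hs).trans (le_abs_self K)) _)
  simp only [Pi.sub_apply, h, sub_self, norm_zero, zero_mul, add_zero, norm_le_zero_iff,
    sub_eq_zero] at this
  exact this

/-- A fixed point theorem in the space of continuous functions bounded by a multiple of a
weight `W`. -/
lemma exists_weighted_fixedPoint [CompleteSpace E] {W : ℝ → ℝ} (hW : Continuous W)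
    (hpos : ∀ x, 0 < W x) (L : (ℝ → E) → ℝ → E)
    (hcont : ∀ w, Continuous w → (∃ C, ∀ x, ‖w x‖ ≤ C * W x) → Continuous (L w))
    (hlip : ∀ v w, Continuous v → Continuous w → (∃ C, ∀ x, ‖v x‖ ≤ C * W x) →
      (∃ C, ∀ x, ‖w x‖ ≤ C * W x) → ∀ C, (∀ x, ‖v x - w x‖ ≤ C * W x) →
      ∀ x, ‖L v x - L w x‖ ≤ C / 2 * W x)
    (hzero : ∃ C, ∀ x, ‖L 0 x‖ ≤ C * W x) :
    ∃ w, Continuous w ∧ (∃ C, ∀ x, ‖w x‖ ≤ C * W x) ∧ L w = w := by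
  have hb : ∀ v : BoundedContinuousFunction ℝ E, ∀ x, ‖W x • v x‖ ≤ ‖v‖ * W x := fun v x => by
    rw [norm_smul, Real.norm_of_nonneg (hpos x).le, mul_comm]
    exact mul_le_mul_of_nonneg_right (v.norm_coe_le_norm x) (hpos x).le
  have hc : ∀ v : BoundedContinuousFunction ℝ E, Continuous fun x => W x • v x := fun v =>
    hW.smul v.continuous
  have hz : ∃ C, ∀ x, ‖(0 : ℝ → E) x‖ ≤ C * W x := ⟨0, by simp⟩
  obtain ⟨C0, hC0⟩ := hzero
  have hbd : ∀ v : BoundedContinuousFunction ℝ E, ∀ x,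
      ‖(W x)⁻¹ • L (fun y => W y • v y) x‖ ≤ ‖v‖ / 2 + C0 := fun v x => by
    have h1 := hlip (fun y => W y • v y) 0 (hc v) continuous_const ⟨_, hb v⟩ hz ‖v‖
      (by simpa using hb v) x
    have h2 := hC0 x
    have h3 : ‖L (fun y => W y • v y) x‖ ≤ (‖v‖ / 2 + C0) * W x := by
      calc _ = ‖(L (fun y => W y • v y) x - L 0 x) + L 0 x‖ := by rw [sub_add_cancel]
        _ ≤ _ := norm_add_le _ _
        _ ≤ _ := by linarith
    rw [norm_smul, norm_inv, Real.norm_of_nonneg (hpos x).le, inv_mul_le_iff₀ (hpos x)]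
    linarith
  -- Conjugating L by multiplication by W turns the weighted norm into the sup norm, where the
  -- contraction principle applies.
  let Φ : BoundedContinuousFunction ℝ E → BoundedContinuousFunction ℝ E := fun v =>
    BoundedContinuousFunction.ofNormedAddCommGroup (fun x => (W x)⁻¹ • L (fun y => W y • v y) x)
      ((hW.inv₀ fun x => (hpos x).ne').smul (hcont _ (hc v) ⟨_, hb v⟩)) _ (hbd v)
  have hΦ : ContractingWith (1 / 2) Φ := by
    refine ⟨by norm_num, LipschitzWith.of_dist_le_mul fun u v => ?_⟩
    rw [BoundedContinuousFunction.dist_le (by positivity)]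
    intro x
    have h1 := hlip (fun y => W y • u y) (fun y => W y • v y) (hc u) (hc v) ⟨_, hb u⟩ ⟨_, hb v⟩
      (dist u v) (fun y => by
        rw [← smul_sub, dist_eq_norm]; exact hb (u - v) y) x
    change dist ((W x)⁻¹ • L (fun y => W y • u y) x) ((W x)⁻¹ • L (fun y => W y • v y) x) ≤ _
    rw [dist_eq_norm, ← smul_sub, norm_smul, norm_inv, Real.norm_of_nonneg (hpos x).le,
      inv_mul_le_iff₀ (hpos x)]
    simp only [NNReal.coe_div, NNReal.coe_one, NNReal.coe_ofNat]
    linarith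
  have hfix := hΦ.fixedPoint_isFixedPt
  set v := hΦ.fixedPoint
  refine ⟨fun x => W x • v x, hc v, ⟨_, hb v⟩, funext fun x => ?_⟩
  have h := DFunLike.congr_fun hfix x
  change (W x)⁻¹ • L (fun y => W y • v y) x = v x at h
  rw [← h, smul_inv_smul₀ (hpos x).ne']

lemma hasDerivAt_exp_two_mul {N : ℝ → ℝ} {n x : ℝ} (h : HasDerivAt N n x) :
    HasDerivAt (fun y => Real.exp (2 * N y) / 2) (n * Real.exp (2 * N x)) x := by
  exact ((h.const_mul 2).exp.div_const 2).congr_deriv (by ring)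

/-- Global existence for linear equations with continuous coefficients. -/
lemma linear_ode_exists [CompleteSpace E] {A : ℝ → E →L[ℝ] E} (hA : Continuous A) (u : E) :
    ∃ f : ℝ → E, f 0 = u ∧ ∀ x, HasDerivAt f (A x (f x)) x := by
  set N : ℝ → ℝ := fun x => ∫ y in (0 : ℝ)..x, ‖A y‖ with hN
  have hNd : ∀ x, HasDerivAt N ‖A x‖ x := fun x =>
    (hA.norm.integral_hasStrictDerivAt 0 x).hasDerivAt
  have hNc : Continuous N := continuous_iff_continuousAt.2 fun x => (hNd x).continuousAt
  have hN0 : N 0 = 0 := by simp [hN]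
  have hNpos : ∀ x, 0 ≤ x → 0 ≤ N x := fun x hx =>
    intervalIntegral.integral_nonneg hx fun _ _ => norm_nonneg _
  have hNneg : ∀ x, x ≤ 0 → N x ≤ 0 := fun x hx => by
    rw [hN]; simp only
    rw [intervalIntegral.integral_symm]
    exact neg_nonpos.2 (intervalIntegral.integral_nonneg hx fun _ _ => norm_nonneg _)
  -- The factor 2 in the exponent produces the contraction constant 1/2: integrating ‖A‖W from 0 to
  -- x gives at most W/2 in absolute value.
  set W : ℝ → ℝ := fun x => Real.exp (2 * |N x|) with hWdef
  have hWc : Continuous W := by fun_prop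
  have hint : ∀ x, |∫ y in (0 : ℝ)..x, ‖A y‖ * W y| ≤ W x / 2 := by
    intro x
    rcases le_total 0 x with hx | hx
    · have : ∫ y in (0 : ℝ)..x, ‖A y‖ * W y = W x / 2 - 1 / 2 := by
        rw [intervalIntegral.integral_congr (g := fun y => ‖A y‖ * Real.exp (2 * N y))]
        · rw [intervalIntegral.integral_eq_sub_of_hasDerivAt
            (fun y _ => hasDerivAt_exp_two_mul (hNd y))]
          · simp [hN0, hWdef, abs_of_nonneg (hNpos x hx)]
          · exact (hA.norm.mul (by fun_prop)).intervalIntegrable _ _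
        · intro y hy
          rw [Set.uIcc_of_le hx] at hy
          simp [hWdef, abs_of_nonneg (hNpos y hy.1)]
      rw [this, abs_le]
      have : 1 ≤ W x := Real.one_le_exp (by positivity)
      constructor <;> linarith
    · have : ∫ y in (0 : ℝ)..x, ‖A y‖ * W y = 1 / 2 - W x / 2 := by
        rw [intervalIntegral.integral_congr (g := fun y => -(-‖A y‖ * Real.exp (2 * -N y)))]
        · rw [intervalIntegral.integral_neg, intervalIntegral.integral_eq_sub_of_hasDerivAt
            (fun y _ => hasDerivAt_exp_two_mul (N := fun x => -N x) (hNd y).neg)]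
          · simp [hN0, hWdef, abs_of_nonpos (hNneg x hx)]
          · exact (hA.norm.neg.mul (by fun_prop)).intervalIntegrable _ _
        · intro y hy
          rw [Set.uIcc_of_ge hx] at hy
          simp [hWdef, abs_of_nonpos (hNneg y hy.2)]
      rw [this, abs_le]
      have : 1 ≤ W x := Real.one_le_exp (by positivity)
      constructor <;> linarith
  have hAc : ∀ w : ℝ → E, Continuous w → Continuous fun y => A y (w y) := fun w hw =>
    hA.clm_apply hw
  obtain ⟨w, hw, -, hfix⟩ := exists_weighted_fixedPoint (E := E) hWc (fun x => Real.exp_pos _)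
    (fun w x => u + ∫ y in (0 : ℝ)..x, A y (w y))
    (fun w hw _ => continuous_const.add (continuous_iff_continuousAt.2 fun x =>
      ((hAc w hw).integral_hasStrictDerivAt 0 x).hasDerivAt.continuousAt))
    (fun v w hv hw _ _ C hC x => by
      rw [add_sub_add_left_eq_sub, ← intervalIntegral.integral_sub
        ((hAc v hv).intervalIntegrable _ _) ((hAc w hw).intervalIntegrable _ _)]
      have hC0 : 0 ≤ C := by
        have := (norm_nonneg _).trans (hC 0)
        exact nonneg_of_mul_nonneg_left this (Real.exp_pos _)
      calc _ ≤ |∫ y in (0 : ℝ)..x, C * (‖A y‖ * W y)| := by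
            refine intervalIntegral.norm_integral_le_abs_of_norm_le
              (Filter.Eventually.of_forall fun y => ?_)
              ((continuous_const.mul (hA.norm.mul hWc)).intervalIntegrable _ _)
            rw [← map_sub]
            refine ((A y).le_opNorm _).trans ?_
            have := mul_le_mul_of_nonneg_left (hC y) (norm_nonneg (A y))
            linarith
        _ = C * |∫ y in (0 : ℝ)..x, ‖A y‖ * W y| := by
            rw [intervalIntegral.integral_const_mul, abs_mul, abs_of_nonneg hC0]
        _ ≤ C * (W x / 2) := mul_le_mul_of_nonneg_left (hint x) hC0
        _ = _ := by ring)
    ⟨‖u‖, fun x => by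
      simp only [Pi.zero_apply, map_zero, intervalIntegral.integral_zero, add_zero]
      exact le_mul_of_one_le_right (norm_nonneg _) (Real.one_le_exp (by positivity))⟩
  refine ⟨w, by rw [← hfix]; simp, fun x => ?_⟩
  have := ((hAc w hw).integral_hasStrictDerivAt 0 x).hasDerivAt.const_add u
  rwa [show (fun x => u + ∫ y in (0 : ℝ)..x, A y (w y)) = w from hfix] at this

omit [NormedSpace ℝ E] in
lemma integrableOn_Ioi_of_continuous {g : ℝ → E} (hg : Continuous g) {a : ℝ}
    (hi : IntegrableOn g (Set.Ioi a)) (x : ℝ) : IntegrableOn g (Set.Ioi x) := by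
  rcases le_total a x with h | h
  · exact hi.mono_set (Set.Ioi_subset_Ioi h)
  · rw [← Set.Ioc_union_Ioi_eq_Ioi h]
    exact (hg.integrableOn_Ioc).union hi

lemma integral_Ioi_eq_sub {g : ℝ → E}
    (hi : ∀ x, IntegrableOn g (Set.Ioi x)) (x : ℝ) :
    ∫ y in Set.Ioi x, g y = (∫ y in Set.Ioi (0 : ℝ), g y) - ∫ y in (0 : ℝ)..x, g y :=
  (sub_eq_of_eq_add' (intervalIntegral.integral_interval_add_Ioi (hi 0) (hi x)).symm).symm

lemma hasDerivAt_integral_Ioi [CompleteSpace E] {g : ℝ → E} (hg : Continuous g)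
    (hi : ∀ x, IntegrableOn g (Set.Ioi x)) (x : ℝ) :
    HasDerivAt (fun x => ∫ y in Set.Ioi x, g y) (-g x) x := by
  rw [funext (integral_Ioi_eq_sub hi)]
  exact (hg.integral_hasStrictDerivAt 0 x).hasDerivAt.const_sub _

lemma tendsto_integral_Ioi {g : ℝ → E} (hi : ∀ x, IntegrableOn g (Set.Ioi x)) :
    Tendsto (fun x => ∫ y in Set.Ioi x, g y) atTop (𝓝 0) := by
  rw [funext (integral_Ioi_eq_sub hi), ← sub_self (∫ y in Set.Ioi (0 : ℝ), g y)]
  exact tendsto_const_nhds.sub (intervalIntegral_tendsto_integral_Ioi 0 (hi 0) tendsto_id)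

end Analysis

/-! ### Solutions with a prescribed limit at +∞. -/

section Levinson

variable {ι : Type*} [Fintype ι]

/-- Existence of solutions of `w' = diag(μ) w + V w` with prescribed limit `w₀ ∈ ker diag(μ)` at
`+∞`, when `V` is integrable at `+∞` and the real parts of the `μ i` are non-negative. -/
lemma exists_solution_tendsto {μ : ι → ℂ} (hμ : ∀ i, 0 ≤ (μ i).re)
    {V : ℝ → (ι → ℂ) →L[ℝ] (ι → ℂ)} (hV : Continuous V)
    (hVi : IntegrableOn (fun y => ‖V y‖) (Set.Ioi 0)) {w₀ : ι → ℂ} (hw₀ : ∀ i, μ i * w₀ i = 0) :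
    ∃ w : ℝ → ι → ℂ, (∀ x, HasDerivAt w (fun i => μ i * w x i + V x (w x) i) x) ∧
      Tendsto w atTop (𝓝 w₀) := by
  have hmi : ∀ x, IntegrableOn (fun y => ‖V y‖) (Set.Ioi x) :=
    integrableOn_Ioi_of_continuous hV.norm hVi
  set N : ℝ → ℝ := fun x => ∫ y in Set.Ioi x, ‖V y‖ with hN
  have hNd : ∀ x, HasDerivAt N (-‖V x‖) x := hasDerivAt_integral_Ioi hV.norm hmi
  have hNc : Continuous N := continuous_iff_continuousAt.2 fun x => (hNd x).continuousAt
  have hNt : Tendsto N atTop (𝓝 0) := tendsto_integral_Ioi hmi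
  have hNpos : ∀ x, 0 ≤ N x := fun x => integral_nonneg fun _ => norm_nonneg _
  -- N is the remaining mass of ‖V‖ beyond x, so ‖V‖W is the derivative of -W/2 and its tail
  -- integral is exactly (W - 1)/2. This is below W/2, and it tends to 0 at +∞.
  set W : ℝ → ℝ := fun x => Real.exp (2 * N x) with hW
  have hWc : Continuous W := by fun_prop
  have hWpos : ∀ x, 0 < W x := fun x => Real.exp_pos _
  have hWone : ∀ x, 1 ≤ W x := fun x => Real.one_le_exp (mul_nonneg zero_le_two (hNpos x))
  have hWt : Tendsto W atTop (𝓝 1) := by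
    have := (Real.continuous_exp.tendsto _).comp (hNt.const_mul 2)
    simpa [hW, Function.comp_def] using this
  have hWd : ∀ x, HasDerivAt (fun y => -(W y / 2)) (‖V x‖ * W x) x := fun x =>
    (hasDerivAt_exp_two_mul (hNd x)).neg.congr_deriv (by simp [hW])
  have hWt' : Tendsto (fun y => -(W y / 2)) atTop (𝓝 (-(1 / 2))) := (hWt.div_const 2).neg
  have hmW : ∀ x, IntegrableOn (fun y => ‖V y‖ * W y) (Set.Ioi x) := fun x =>
    integrableOn_Ioi_deriv_of_nonneg' (fun y _ => hWd y)
      (fun y _ => mul_nonneg (norm_nonneg _) (hWpos y).le) hWt'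
  have hmWint : ∀ x, ∫ y in Set.Ioi x, ‖V y‖ * W y = (W x - 1) / 2 := fun x => by
    rw [integral_Ioi_of_hasDerivAt_of_tendsto' (fun y _ => hWd y) (hmW x) hWt']
    ring
  -- Variation of constants based at +∞: only |e^{μ(x-y)}| with y ≥ x occurs, and it is at most 1
  -- because Re μ ≥ 0.
  set g : ι → (ℝ → ι → ℂ) → ℝ → ℂ := fun i w y => exp (-(μ i * y)) * V y (w y) i with hg
  have hgc : ∀ i w, Continuous w → Continuous (g i w) := fun i w hw => by
    have h1 : Continuous fun y => V y (w y) := hV.clm_apply hw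
    have h2 : Continuous fun y => V y (w y) i := (continuous_apply i).comp h1
    exact (Complex.continuous_exp.comp
      (continuous_const.mul Complex.continuous_ofReal).neg).mul h2
  have hgb : ∀ i w C, (∀ x, ‖w x‖ ≤ C * W x) → ∀ x y : ℝ, x ≤ y →
      ‖exp (μ i * x) * g i w y‖ ≤ C * (‖V y‖ * W y) := fun i w C hC x y hxy => by
    rw [hg]; simp only
    rw [← mul_assoc, ← Complex.exp_add, norm_mul, Complex.norm_exp]
    have h1 : (μ i * x + -(μ i * y)).re ≤ 0 := by
      simp only [add_re, neg_re, mul_re, ofReal_re, ofReal_im, mul_zero, sub_zero]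
      nlinarith [hμ i]
    have h2 : ‖V y (w y) i‖ ≤ C * (‖V y‖ * W y) :=
      calc _ ≤ ‖V y (w y)‖ := norm_le_pi_norm _ i
        _ ≤ ‖V y‖ * ‖w y‖ := (V y).le_opNorm _
        _ ≤ ‖V y‖ * (C * W y) := mul_le_mul_of_nonneg_left (hC y) (norm_nonneg _)
        _ = _ := by ring
    calc _ ≤ 1 * ‖V y (w y) i‖ :=
          mul_le_mul_of_nonneg_right (Real.exp_le_one_iff.2 h1) (norm_nonneg _)
      _ ≤ _ := by rwa [one_mul]
  have hgi : ∀ i w, Continuous w → (∃ C, ∀ x, ‖w x‖ ≤ C * W x) →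
      ∀ x, IntegrableOn (g i w) (Set.Ioi x) := fun i w hw ⟨C, hC⟩ x => by
    have h1 : IntegrableOn (fun y => exp (μ i * x) * g i w y) (Set.Ioi x) := by
      refine Integrable.mono' ((hmW x).const_mul C)
        (continuous_const.mul (hgc i w hw)).aestronglyMeasurable ?_
      filter_upwards [ae_restrict_mem measurableSet_Ioi] with y hy
      exact hgb i w C hC x y (le_of_lt hy)
    have h2 := h1.const_mul (exp (μ i * x))⁻¹
    simp only [← mul_assoc, inv_mul_cancel₀ (Complex.exp_ne_zero _), one_mul] at h2
    exact h2
  set G : ι → (ℝ → ι → ℂ) → ℝ → ℂ := fun i w x => exp (μ i * x) * ∫ y in Set.Ioi x, g i w y with hG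
  have hGb : ∀ i w C, Continuous w → (∀ x, ‖w x‖ ≤ C * W x) → ∀ x,
      ‖G i w x‖ ≤ C * ((W x - 1) / 2) := fun i w C hw hC x => by
    rw [hG]; simp only
    rw [← integral_const_mul, ← hmWint, ← integral_const_mul]
    refine norm_integral_le_of_norm_le ((hmW x).const_mul C) ?_
    filter_upwards [ae_restrict_mem measurableSet_Ioi] with y hy
    exact hgb i w C hC x y (le_of_lt hy)
  have hGd : ∀ i w, Continuous w → (∃ C, ∀ x, ‖w x‖ ≤ C * W x) → ∀ x,
      HasDerivAt (G i w) (μ i * G i w x - V x (w x) i) x := fun i w hw hC x => by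
    have h1 : HasDerivAt (fun x : ℝ => exp (μ i * x)) (exp (μ i * x) * μ i) x := by
      simpa using ((hasDerivAt_id x).ofReal_comp.const_mul (μ i)).cexp
    refine (h1.mul (hasDerivAt_integral_Ioi (hgc i w hw) (hgi i w hw hC) x)).congr_deriv ?_
    have h2 : exp (μ i * x) * exp (-(μ i * x)) = 1 := by rw [← Complex.exp_add]; simp
    simp only [hG, hg]
    linear_combination (-(V x (w x) i)) * h2
  have hGsub : ∀ i v w, Continuous v → Continuous w → (∃ C, ∀ x, ‖v x‖ ≤ C * W x) →
      (∃ C, ∀ x, ‖w x‖ ≤ C * W x) → ∀ x, G i v x - G i w x = G i (v - w) x :=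
    fun i v w hv hw hCv hCw x => by
      simp only [hG]
      rw [← mul_sub, ← integral_sub (hgi i v hv hCv x) (hgi i w hw hCw x)]
      simp [hg, mul_sub]
  obtain ⟨w, hw, ⟨C, hC⟩, hfix⟩ := exists_weighted_fixedPoint (E := ι → ℂ) hWc hWpos
    (fun w x i => w₀ i - G i w x)
    (fun w hw hC => continuous_pi fun i => continuous_const.sub
      (continuous_iff_continuousAt.2 fun x => (hGd i w hw hC x).continuousAt))
    (fun v w hv hw hCv hCw C hC x => by
      have hC0 : 0 ≤ C := nonneg_of_mul_nonneg_left ((norm_nonneg _).trans (hC 0)) (hWpos 0)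
      refine (pi_norm_le_iff_of_nonneg (mul_nonneg (by positivity) (hWpos x).le)).2 fun i => ?_
      simp only [Pi.sub_apply]
      rw [sub_sub_sub_cancel_left, ← neg_sub, norm_neg, hGsub i v w hv hw hCv hCw]
      refine (hGb i _ C (hv.sub hw) hC x).trans ?_
      nlinarith)
    ⟨‖w₀‖, fun x => by
      have h0 : ∀ i, G i 0 x = 0 := fun i => by simp [hG, hg]
      simp only [h0, sub_zero]
      exact le_mul_of_one_le_right (norm_nonneg _) (hWone x)⟩
  have hfix' : ∀ x i, w x i = w₀ i - G i w x := fun x i => (congrFun (congrFun hfix x) i).symm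
  refine ⟨w, fun x => hasDerivAt_pi.2 fun i => ?_, tendsto_pi_nhds.2 fun i => ?_⟩
  · rw [show (fun x => w x i) = fun x => w₀ i - G i w x from funext fun x => hfix' x i]
    refine ((hGd i w hw ⟨C, hC⟩ x).const_sub (w₀ i)).congr_deriv ?_
    rw [hfix' x i]
    -- The constant vector w₀ solves the unperturbed equation; this is where it must lie in the
    -- kernel of diag(μ).
    linear_combination (-1 : ℂ) * hw₀ i
  · rw [show (fun x => w x i) = fun x => w₀ i - G i w x from funext fun x => hfix' x i]
    have : Tendsto (G i w) atTop (𝓝 0) := by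
      refine squeeze_zero_norm (hGb i w C hw hC) ?_
      have := ((hWt.sub_const 1).div_const 2).const_mul C
      simpa using this
    simpa using this.const_sub (w₀ i)

end Levinson

/-! ### Zero curvature and evolution in time. -/

section Flow

variable {E : Type*} [NormedAddCommGroup E] [NormedSpace ℝ E]

lemma eventually_forall_uIcc_norm_sub_lt {F : Type*} [NormedAddCommGroup F] {f : ℝ → ℝ → F}
    (hf : Continuous fun p : ℝ × ℝ => f p.1 p.2) (a b t : ℝ) {η : ℝ} (hη : 0 < η) :
    ∀ᶠ s in 𝓝 t, ∀ y ∈ Set.uIcc a b, ‖f y s - f y t‖ < η := by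
  refine isCompact_uIcc.eventually_forall_of_forall_eventually fun y _ => ?_
  have h : Continuous fun p : ℝ × ℝ => ‖f p.2 p.1 - f p.2 t‖ :=
    ((hf.comp (continuous_snd.prodMk continuous_fst)).sub
      (hf.comp (continuous_snd.prodMk continuous_const))).norm
  exact h.continuousAt.eventually_lt continuousAt_const (by simpa using hη)

lemma eventually_forall_uIcc_norm_taylor_le {F : Type*} [NormedAddCommGroup F] [NormedSpace ℝ F]
    {f f' : ℝ → ℝ → F} (hf : ∀ x t, HasDerivAt (f x) (f' x t) t)
    (hf' : Continuous fun p : ℝ × ℝ => f' p.1 p.2) (a b t : ℝ) {η : ℝ} (hη : 0 < η) :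
    ∀ᶠ s in 𝓝 t, ∀ y ∈ Set.uIcc a b, ‖f y s - f y t - (s - t) • f' y t‖ ≤ η * |s - t| := by
  obtain ⟨r, hr, h⟩ := Metric.eventually_nhds_iff_ball.1
    (eventually_forall_uIcc_norm_sub_lt hf' a b t hη)
  filter_upwards [Metric.ball_mem_nhds t hr] with s hs y hy
  have := (convex_ball t r).norm_image_sub_le_of_norm_hasDerivWithin_le
    (f := fun s => f y s - s • f' y t) (f' := fun s => f' y s - f' y t) (C := η)
    (fun u _ => ((hf y u).sub (by simpa using (hasDerivAt_id u).smul_const (f' y t))).hasDerivWithinAt)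
    (fun u hu => (h u hu y hy).le) (Metric.mem_ball_self hr) hs
  rw [Real.norm_eq_abs] at this
  convert this using 2
  module

/-- If `X_t + X T = T_x + T X`, and `ψ(·,t)` solves `ψ_x = X ψ` for every `t`, while `ψ(0,·)` solves
`ψ_t = T ψ`, then `ψ_t = T ψ` everywhere. -/
lemma hasDerivAt_time_of_zero_curvature {X T X' T' : ℝ → ℝ → E →L[ℝ] E}
    (hX : Continuous fun p : ℝ × ℝ => X p.1 p.2) (hX' : Continuous fun p : ℝ × ℝ => X' p.1 p.2)
    (hXd : ∀ x t, HasDerivAt (X x) (X' x t) t) (hTd : ∀ x t, HasDerivAt (fun y => T y t) (T' x t) x)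
    (hzc : ∀ x t v, X' x t v + X x t (T x t v) = T' x t v + T x t (X x t v))
    {ψ : ℝ → ℝ → E} (hψx : ∀ x t, HasDerivAt (fun y => ψ y t) (X x t (ψ x t)) x)
    (hψ0 : ∀ t, HasDerivAt (ψ 0) (T 0 t (ψ 0 t)) t) (x t : ℝ) :
    HasDerivAt (ψ x) (T x t (ψ x t)) t := by
  have hψc : Continuous fun y => ψ y t :=
    continuous_iff_continuousAt.2 fun y => (hψx y t).continuousAt
  have hTc : Continuous fun y => T y t :=
    continuous_iff_continuousAt.2 fun y => (hTd y t).continuousAt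
  obtain ⟨C₁, hC₁⟩ := isCompact_uIcc.exists_bound_of_continuousOn (hψc.continuousOn (s := Set.uIcc 0 x))
  obtain ⟨C₂, hC₂⟩ := isCompact_uIcc.exists_bound_of_continuousOn
    ((hTc.clm_apply hψc).continuousOn (s := Set.uIcc 0 x))
  obtain ⟨K, hK⟩ := isCompact_uIcc.exists_bound_of_continuousOn
    ((hX.comp (continuous_id.prodMk (continuous_const (y := t)))).continuousOn (s := Set.uIcc 0 x))
  have h0mem : (0 : ℝ) ∈ Set.uIcc 0 x := Set.left_mem_uIcc
  have hC₁0 : 0 ≤ C₁ := (norm_nonneg _).trans (hC₁ 0 h0mem)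
  have hC₂0 : 0 ≤ C₂ := (norm_nonneg _).trans (hC₂ 0 h0mem)
  have hK0 : 0 ≤ K := (norm_nonneg _).trans (hK 0 h0mem)
  set M := (1 + (C₁ + C₂) * |x|) * Real.exp ((K + 1) * |x|) with hM
  have hMpos : 0 < M := by positivity
  rw [hasDerivAt_iff_isLittleO, Asymptotics.isLittleO_iff]
  intro c hc
  -- The bound η ≤ 1 keeps ‖X(·,s)‖ below K + 1, and M is the constant that Grönwall's inequality
  -- produces in front of η|s - t|.
  obtain ⟨η, hη, hη1, hηM⟩ : ∃ η : ℝ, 0 < η ∧ η ≤ 1 ∧ η * M ≤ c :=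
    ⟨min 1 (c / M), by positivity, min_le_left _ _, by
      calc _ ≤ c / M * M := mul_le_mul_of_nonneg_right (min_le_right _ _) hMpos.le
        _ = c := by field_simp⟩
  have hinit := (Asymptotics.isLittleO_iff.1 (hasDerivAt_iff_isLittleO.1 (hψ0 t))) hη
  filter_upwards [hinit, eventually_forall_uIcc_norm_sub_lt hX 0 x t hη,
    eventually_forall_uIcc_norm_taylor_le hXd hX' 0 x t hη] with s hs1 hs2 hs3
  -- The first-order Taylor remainder of ψ in time, with Tψ as the candidate derivative, solves the
  -- x-equation at time s up to a source term. Zero curvature cancels the source to first order in s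
  -- - t, so Grönwall in x, started from the known derivative at x = 0, bounds the remainder by o(s
  -- - t). Differentiability of ψ in t is a conclusion here.
  have hD := norm_le_of_norm_deriv_le
    (f := fun y => ψ y s - ψ y t - (s - t) • T y t (ψ y t))
    (f' := fun y => X y s (ψ y s - ψ y t - (s - t) • T y t (ψ y t))
      + (s - t) • (X y s - X y t) (T y t (ψ y t))
      + (X y s - X y t - (s - t) • X' y t) (ψ y t))
    (K := K + 1) (ε := η * |s - t| * (C₁ + C₂)) (a := 0) (b := x) (by positivity) (by positivity)
    (fun y _ => by
      refine (((hψx y s).sub (hψx y t)).sub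
        (((hTd y t).clm_apply (hψx y t)).const_smul (s - t))).congr_deriv ?_
      rw [← hzc]
      simp only [sub_apply, smul_apply, map_sub, map_smul]
      module)
    (fun y hy => by
      have e1 : ‖X y s‖ ≤ K + 1 := by
        have := norm_le_norm_add_norm_sub' (X y s) (X y t)
        have h1 := hs2 y hy
        have h2 : ‖X y t‖ ≤ K := hK y hy
        linarith
      have e2 := (X y s).le_of_opNorm_le e1 (ψ y s - ψ y t - (s - t) • T y t (ψ y t))
      have e3 : ‖(s - t) • (X y s - X y t) (T y t (ψ y t))‖ ≤ |s - t| * (η * C₂) := by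
        rw [norm_smul, Real.norm_eq_abs]
        exact mul_le_mul_of_nonneg_left ((ContinuousLinearMap.le_of_opNorm_le _ (hs2 y hy).le _).trans
          (mul_le_mul_of_nonneg_left (hC₂ y hy) hη.le)) (abs_nonneg _)
      have e4 : ‖(X y s - X y t - (s - t) • X' y t) (ψ y t)‖ ≤ η * |s - t| * C₁ :=
        (ContinuousLinearMap.le_of_opNorm_le _ (hs3 y hy) _).trans
          (mul_le_mul_of_nonneg_left (hC₁ y hy) (by positivity))
      refine (norm_add₃_le).trans ?_
      linarith)
  simp only [sub_zero] at hD
  rw [Real.norm_eq_abs] at hs1 ⊢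
  refine hD.trans ?_
  calc _ ≤ (η * |s - t| + η * |s - t| * (C₁ + C₂) * |x|) * Real.exp ((K + 1) * |x|) := by gcongr
    _ = η * M * |s - t| := by rw [hM]; ring
    _ ≤ _ := by gcongr

/-- Solutions of `ψ_x = X ψ` at `t = 0` extend to simultaneous solutions of the zero curvature
system. -/
lemma exists_simultaneous_solution [CompleteSpace E] {X T X' T' : ℝ → ℝ → E →L[ℝ] E}
    (hX : Continuous fun p : ℝ × ℝ => X p.1 p.2) (hX' : Continuous fun p : ℝ × ℝ => X' p.1 p.2)
    (hXd : ∀ x t, HasDerivAt (X x) (X' x t) t) (hTd : ∀ x t, HasDerivAt (fun y => T y t) (T' x t) x)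
    (hT0 : Continuous (T 0))
    (hzc : ∀ x t v, X' x t v + X x t (T x t v) = T' x t v + T x t (X x t v))
    {φ : ℝ → E} (hφ : ∀ x, HasDerivAt φ (X x 0 (φ x)) x) :
    ∃ ψ : ℝ → ℝ → E, (∀ x, ψ x 0 = φ x) ∧ (∀ x t, HasDerivAt (fun y => ψ y t) (X x t (ψ x t)) x) ∧
      ∀ x t, HasDerivAt (ψ x) (T x t (ψ x t)) t := by
  -- The time equation is solved on the line x = 0 only; for each t the spatial equation is then
  -- solved from that value.
  obtain ⟨c, hc0, hc⟩ := linear_ode_exists hT0 (φ 0)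
  have hXt : ∀ t, Continuous fun y => X y t := fun t =>
    hX.comp (continuous_id.prodMk continuous_const)
  choose f hf0 hf using fun t => linear_ode_exists (hXt t) (c t)
  refine ⟨fun x t => f t x, fun x => ?_, fun x t => hf t x,
    hasDerivAt_time_of_zero_curvature hX hX' hXd hTd hzc (fun x t => hf t x) fun t => ?_⟩
  · exact linear_ode_unique (hXt 0) (hf 0) hφ ((hf0 0).trans hc0) x
  · simp only [hf0]
    exact hc t

lemma eventually_forall_compact_norm_sub_lt {F : Type*} [NormedAddCommGroup F] {f : ℝ → ℝ → F}
    {u : F} {l : Filter ℝ} {K : Set ℝ} (hK : IsCompact K)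
    (hf : ∀ t, Tendsto (fun p : ℝ × ℝ => f p.1 p.2) (l ×ˢ 𝓝 t) (𝓝 u)) {ε : ℝ} (hε : 0 < ε) :
    ∀ᶠ x in l, ∀ s ∈ K, ‖f x s - u‖ < ε := by
  have h : {p : ℝ × ℝ | ‖f p.1 p.2 - u‖ < ε} ∈ l ×ˢ 𝓝ˢ K := by
    refine hK.mem_prod_nhdsSet_of_forall fun s _ => ?_
    have h1 : Tendsto (fun p : ℝ × ℝ => ‖f p.1 p.2 - u‖) (l ×ˢ 𝓝 s) (𝓝 0) :=
      tendsto_iff_norm_sub_tendsto_zero.1 (hf s)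
    exact h1.eventually_lt_const hε
  obtain ⟨a, ha, b, hb, hab⟩ := Filter.mem_prod_iff.1 h
  filter_upwards [ha] with x hx s hs
  exact hab (Set.mk_mem_prod hx (subset_of_mem_nhdsSet hb hs))

/-- Propagation in `t` of the asymptotics of a solution of `ψ_t = T ψ`. -/
lemma tendsto_of_hasDerivAt_time {S : ℝ → ℝ → E →L[ℝ] E} {S₀ : E →L[ℝ] E} {l : Filter ℝ}
    (hS : ∀ t, Tendsto (fun p : ℝ × ℝ => S p.1 p.2) (l ×ˢ 𝓝 t) (𝓝 S₀)) {Y : E} (hY : S₀ Y = 0)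
    {f : ℝ → ℝ → E} (hf : ∀ x t, HasDerivAt (f x) (S x t (f x t)) t)
    (h0 : Tendsto (fun x => f x 0) l (𝓝 Y)) (t : ℝ) : Tendsto (fun x => f x t) l (𝓝 Y) := by
  have hev : ∀ ε : ℝ, 0 < ε → ∀ᶠ x in l, ∀ s ∈ Set.uIcc 0 t, ‖S x s - S₀‖ < ε :=
    fun ε hε => eventually_forall_compact_norm_sub_lt isCompact_uIcc hS hε
  set A := Real.exp ((‖S₀‖ + 1) * |t|)
  rw [tendsto_iff_norm_sub_tendsto_zero] at h0 ⊢
  rw [Metric.tendsto_nhds]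
  intro ε hε
  set ε' := ε / (A * (1 + ‖Y‖ * |t|) + 1) with hε'
  have hε'pos : 0 < ε' := by positivity
  have hε'le : ε' * (A * (1 + ‖Y‖ * |t|)) < ε := by
    rw [hε', div_mul_eq_mul_div, div_lt_iff₀ (by positivity)]
    nlinarith
  filter_upwards [hev 1 one_pos, hev ε' hε'pos, h0.eventually_lt_const hε'pos] with x h1 h2 h3
  have := norm_le_of_norm_deriv_le (f := fun s => f x s - Y) (f' := fun s => S x s (f x s))
    (K := ‖S₀‖ + 1) (ε := ε' * ‖Y‖) (a := 0) (b := t) (by positivity) (by positivity)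
    (fun s _ => (hf x s).sub_const Y)
    (fun s hs => by
      -- Since S₀ Y = 0, the deviation f - Y is driven only by (S - S₀) Y, which is uniformly small
      -- on the time interval near the end l.
      have e1 : S x s (f x s) = S x s (f x s - Y) + (S x s - S₀) Y := by
        simp [hY]
      have e2 : ‖S x s‖ ≤ ‖S₀‖ + 1 := by
        have := norm_le_norm_add_norm_sub' (S x s) S₀
        have := h1 s hs
        linarith
      rw [e1]
      exact (norm_add_le _ _).trans (add_le_add ((S x s).le_of_opNorm_le e2 _)
        (ContinuousLinearMap.le_of_opNorm_le _ (h2 s hs).le _)))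
  rw [sub_zero] at this
  rw [dist_zero_right, norm_norm]
  refine this.trans_lt (lt_of_le_of_lt ?_ hε'le)
  calc _ ≤ (ε' + ε' * ‖Y‖ * |t|) * A := by gcongr
    _ = _ := by ring

end Flow

/-! ### The Lax matrices in coordinates. -/

/-- The action of a matrix on column vectors, as a real linear map into bounded operators. -/
def mulVecCLM : Matrix (Fin 2) (Fin 2) ℂ →ₗ[ℝ] ((Fin 2 → ℂ) →L[ℝ] (Fin 2 → ℂ)) where
  toFun M := LinearMap.toContinuousLinearMap (M.mulVecLin.restrictScalars ℝ)
  map_add' M N := by ext v; simp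
  map_smul' c M := by ext v; simp

@[simp]
lemma mulVecCLM_apply (M : Matrix (Fin 2) (Fin 2) ℂ) (v : Fin 2 → ℂ) :
    mulVecCLM M v = M.mulVec v := rfl

lemma continuous_mulVecCLM : Continuous mulVecCLM :=
  LinearMap.continuous_of_finiteDimensional _

lemma hasDerivAt_mulVecCLM {M : ℝ → Matrix (Fin 2) (Fin 2) ℂ} {M' : Matrix (Fin 2) (Fin 2) ℂ}
    {x : ℝ} (h : ∀ i j, HasDerivAt (fun y => M y i j) (M' i j) x) :
    HasDerivAt (fun y => mulVecCLM (M y)) (mulVecCLM M') x := by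
  let c : (Fin 2 → Fin 2 → ℂ) →L[ℝ] ((Fin 2 → ℂ) →L[ℝ] (Fin 2 → ℂ)) :=
    LinearMap.toContinuousLinearMap
      { toFun := fun M => mulVecCLM (Matrix.of M)
        map_add' := fun M N => mulVecCLM.map_add (Matrix.of M) (Matrix.of N)
        map_smul' := fun r M => mulVecCLM.map_smul r (Matrix.of M) }
  have hM : HasDerivAt (fun y i j => M y i j) (fun i j => M' i j) x :=
    hasDerivAt_pi.2 fun i => hasDerivAt_pi.2 fun j => h i j
  exact c.hasFDerivAt.comp_hasDerivAt x hM

lemma hasDerivAt_conj {f : ℝ → ℂ} {f' : ℂ} {x : ℝ} (h : HasDerivAt f f' x) :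
    HasDerivAt (fun y => conj (f y)) (conj f') x := h.star

lemma norm_sq_eq (u : ℂ) : (‖u‖ : ℂ) ^ 2 = u * conj u := (Complex.mul_conj' u).symm

lemma laxX_eq (q0 : ℝ) (q : ℝ → ℝ → ℂ) (z : ℂ) (x t : ℝ) :
    laxX q0 q z x t = !![-(I * kOf q0 z), q x t; -conj (q x t), I * kOf q0 z] := by
  ext i j; fin_cases i <;> fin_cases j <;> simp [laxX, sigma3, potMat]

/-- The matrix `T` in terms of `k`, of the value `u` of `q` and of the value `v` of `q_x`. -/
def laxTMat (q0 : ℝ) (k u v : ℂ) : Matrix (Fin 2) (Fin 2) ℂ :=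
  !![-(I * k ^ 2) - I / 2 * ((q0 : ℂ) ^ 2 - u * conj u), k * u + I / 2 * v;
    -(k * conj u) + I / 2 * conj v, I * k ^ 2 + I / 2 * ((q0 : ℂ) ^ 2 - u * conj u)]

lemma laxT_eq (q0 : ℝ) (q : ℝ → ℝ → ℂ) (z : ℂ) (x t : ℝ) :
    laxT q0 q z x t = laxTMat q0 (kOf q0 z) (q x t) (deriv (fun y => q y t) x) := by
  ext i j; fin_cases i <;> fin_cases j <;>
    simp [laxT, laxTMat, sigma3, potMat, pow_two, Matrix.mul_apply, Fin.sum_univ_two] <;> ring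

lemma continuous_laxTMat (q0 : ℝ) (k : ℂ) :
    Continuous fun p : ℂ × ℂ => laxTMat q0 k p.1 p.2 := by
  refine continuous_matrix fun i j => ?_
  have h : Continuous fun w : ℂ => conj w := Complex.continuous_conj
  fin_cases i <;> fin_cases j <;> simp [laxTMat] <;> fun_prop

lemma eigY_eq (qb z : ℂ) : eigY qb z = !![1, -(I / z * qb); -(I / z * conj qb), 1] := by
  ext i j; fin_cases i <;> fin_cases j <;> simp [eigY, sigma3, potMat]



/-! ### The sign of Im λ and the zeros of γ. -/

lemma im_lamOf (q0 : ℝ) (z : ℂ) :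
    (lamOf q0 z).im = (‖z‖ ^ 2 - q0 ^ 2) * z.im / (2 * ‖z‖ ^ 2) := by
  by_cases hz : z = 0
  · simp [hz, lamOf]
  have h : (‖z‖ ^ 2 : ℝ) = Complex.normSq z := (Complex.normSq_eq_norm_sq z).symm
  have h0 : Complex.normSq z ≠ 0 := fun h => hz (Complex.normSq_eq_zero.1 h)
  have : lamOf q0 z = (z + ((q0 ^ 2 : ℝ) : ℂ) / z) / 2 := by simp [lamOf]
  rw [h, this]
  simp only [Complex.div_im, Complex.add_im, Complex.div_im, Complex.ofReal_re, Complex.ofReal_im]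
  simp [Complex.normSq_ofNat]
  field_simp
  ring

lemma ne_zero_of_mem_DMinus {q0 : ℝ} {z : ℂ} (hz : z ∈ DMinus q0) : z ≠ 0 := by
  rintro rfl; simp [DMinus] at hz

lemma ne_zero_of_mem_DPlus {q0 : ℝ} {z : ℂ} (hz : z ∈ DPlus q0) : z ≠ 0 := by
  rintro rfl; simp [DPlus] at hz

lemma im_lamOf_neg {q0 : ℝ} {z : ℂ} (hz : z ∈ DMinus q0) : (lamOf q0 z).im < 0 := by
  rw [im_lamOf]
  have := norm_pos_iff.2 (ne_zero_of_mem_DMinus hz)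
  exact div_neg_of_neg_of_pos hz (by positivity)

lemma im_lamOf_pos {q0 : ℝ} {z : ℂ} (hz : z ∈ DPlus q0) : 0 < (lamOf q0 z).im := by
  rw [im_lamOf]
  have := norm_pos_iff.2 (ne_zero_of_mem_DPlus hz)
  exact div_pos hz (by positivity)

/-- The zeros ±i q₀ of γ lie on the circle, hence on the contour. -/
lemma gam_ne_zero {q0 : ℝ} {z : ℂ} (hz0 : z ≠ 0) (hq0 : 0 < q0) (hz : ‖z‖ ≠ q0) :
    gam q0 z ≠ 0 := by
  intro h
  have h1 : z ^ 2 = -(q0 : ℂ) ^ 2 := by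
    have : z ^ 2 ≠ 0 := pow_ne_zero 2 hz0
    rw [gam] at h
    field_simp at h
    linear_combination h
  have h2 : ‖z‖ ^ 2 = q0 ^ 2 := by
    rw [← norm_pow, h1]; simp
  exact hz ((pow_left_inj₀ (norm_nonneg z) hq0.le two_ne_zero).1 h2)

lemma norm_ne_of_mem_DMinus {q0 : ℝ} {z : ℂ} (hz : z ∈ DMinus q0) : ‖z‖ ≠ q0 := by
  rintro rfl; simp [DMinus] at hz

lemma norm_ne_of_mem_DPlus {q0 : ℝ} {z : ℂ} (hz : z ∈ DPlus q0) : ‖z‖ ≠ q0 := by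
  rintro rfl; simp [DPlus] at hz

/-! ### Regularity of the coefficients and the zero curvature identity. -/

namespace IsPotential

variable {q0 : ℝ} {qm qp : ℂ} {q : ℝ → ℝ → ℂ}

lemma mul_conj_qp (hq : IsPotential q0 qm qp q) : qp * conj qp = (q0 : ℂ) ^ 2 := by
  rw [← norm_sq_eq, hq.norm_qp]

lemma mul_conj_qm (hq : IsPotential q0 qm qp q) : qm * conj qm = (q0 : ℂ) ^ 2 := by
  rw [← norm_sq_eq, hq.norm_qm]

lemma qp_ne_zero (hq : IsPotential q0 qm qp q) : qp ≠ 0 := by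
  rw [← norm_pos_iff, hq.norm_qp]; exact hq.q0_pos

lemma qm_ne_zero (hq : IsPotential q0 qm qp q) : qm ≠ 0 := by
  rw [← norm_pos_iff, hq.norm_qm]; exact hq.q0_pos

lemma ofReal_q0_ne_zero (hq : IsPotential q0 qm qp q) : (q0 : ℂ) ≠ 0 :=
  Complex.ofReal_ne_zero.2 hq.q0_pos.ne'

lemma hasDerivAt_x (hq : IsPotential q0 qm qp q) (x t : ℝ) :
    HasDerivAt (fun y => q y t) (deriv (fun y => q y t) x) x :=
  ((hq.contDiff_x t).differentiable (by norm_num) x).hasDerivAt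

lemma hasDerivAt_t (hq : IsPotential q0 qm qp q) (x t : ℝ) :
    HasDerivAt (q x) (deriv (fun s => q x s) t) t :=
  ((hq.contDiff_t x).differentiable (by norm_num) t).hasDerivAt

lemma hasDerivAt_xx (hq : IsPotential q0 qm qp q) (x t : ℝ) :
    HasDerivAt (deriv fun y => q y t) (iteratedDeriv 2 (fun y => q y t) x) x := by
  rw [iteratedDeriv_succ, iteratedDeriv_one]
  have h : ContDiff ℝ (1 + 1) (fun y => q y t) := hq.contDiff_x t
  exact ((contDiff_succ_iff_deriv.1 h).2.2.differentiable (by norm_num) x).hasDerivAt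

lemma continuous_laxX (hq : IsPotential q0 qm qp q) (z : ℂ) :
    Continuous fun p : ℝ × ℝ => mulVecCLM (laxX q0 q z p.1 p.2) := by
  refine continuous_mulVecCLM.comp (continuous_matrix fun i j => ?_)
  have h := hq.continuous_q
  have h' : Continuous fun p : ℝ × ℝ => conj (q p.1 p.2) := Complex.continuous_conj.comp h
  simp only [laxX_eq]
  fin_cases i <;> fin_cases j
  exacts [continuous_const, h, h'.neg, continuous_const]

lemma continuous_laxT_zero (hq : IsPotential q0 qm qp q) (z : ℂ) :
    Continuous fun t : ℝ => mulVecCLM (laxT q0 q z 0 t) := by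
  simp only [laxT_eq]
  have h : Continuous fun t : ℝ => ((0 : ℝ), t) := by fun_prop
  have h1 : Continuous fun t => q 0 t := hq.continuous_q.comp h
  have h2 : Continuous fun t => deriv (fun y => q y t) 0 := hq.continuous_qx.comp h
  have h3 := (continuous_laxTMat q0 (kOf q0 z)).comp (h1.prodMk h2)
  exact continuous_mulVecCLM.comp h3

lemma hasDerivAt_laxX (hq : IsPotential q0 qm qp q) (z : ℂ) (x t : ℝ) :
    HasDerivAt (fun t => mulVecCLM (laxX q0 q z x t))
      (mulVecCLM (potMat (deriv (fun s => q x s) t))) t := by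
  refine hasDerivAt_mulVecCLM fun i j => ?_
  have h := hq.hasDerivAt_t x t
  simp only [laxX_eq]
  fin_cases i <;> fin_cases j <;> simp [potMat, -hasDerivAt_deriv_iff]
  · exact hasDerivAt_const _ _
  · exact h
  · exact (hasDerivAt_conj h).neg
  · exact hasDerivAt_const _ _

/-- The `x`-derivative of `T`. -/
lemma hasDerivAt_laxT (hq : IsPotential q0 qm qp q) (z : ℂ) (x t : ℝ) :
    HasDerivAt (fun x => mulVecCLM (laxT q0 q z x t))
      (mulVecCLM (potMat (deriv (fun s => q x s) t)
        + laxX q0 q z x t * laxT q0 q z x t - laxT q0 q z x t * laxX q0 q z x t)) x := by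
  have h1 := hq.hasDerivAt_x x t
  have h2 := hq.hasDerivAt_xx x t
  have h1c := hasDerivAt_conj h1
  have h2c := hasDerivAt_conj h2
  have h3 : HasDerivAt (fun y => (q0 : ℂ) ^ 2 - q y t * conj (q y t)) _ x :=
    (h1.mul h1c).const_sub ((q0 : ℂ) ^ 2)
  -- The equation for q and its conjugate give the two off-diagonal entries of T_x = Q_t + [X, T];
  -- the diagonal entries hold identically.
  have e := hq.equation x t
  have ec := congrArg conj e
  rw [norm_sq_eq] at e ec
  simp only [map_add, map_mul, map_sub, map_pow, map_div₀, conj_I, conj_ofReal, map_ofNat,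
    conj_conj, map_zero] at ec
  have hI := Complex.I_sq
  refine hasDerivAt_mulVecCLM fun i j => ?_
  simp only [laxX_eq, laxT_eq, laxTMat]
  fin_cases i <;> fin_cases j <;> simp [potMat]
  · refine ((h3.const_mul (I / 2)).const_sub (-(I * kOf q0 z ^ 2))).congr_deriv ?_
    ring
  · refine ((h1.const_mul (kOf q0 z)).add (h2.const_mul (I / 2))).congr_deriv ?_
    linear_combination I * e
      + (kOf q0 z * deriv (fun y => q y t) x - deriv (fun s => q x s) t) * hI
  · refine ((h1c.const_mul (kOf q0 z)).neg.add (h2c.const_mul (I / 2))).congr_deriv ?_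
    linear_combination I * ec + (conj (deriv (fun s => q x s) t)
      - kOf q0 z * conj (deriv (fun y => q y t) x)) * hI
  · refine (h3.const_mul (I / 2)).congr_deriv ?_
    ring

end IsPotential

/-! ### Construction of ψ_{+,1} on D⁻. -/

/-- The inverse of `eigY qb z`, for `|qb| = q0`. -/
def eigYInv (q0 : ℝ) (qb z : ℂ) : Matrix (Fin 2) (Fin 2) ℂ :=
  (gam q0 z)⁻¹ • !![1, I / z * qb; I / z * conj qb, 1]

lemma eigY_mul_eigYInv {q0 : ℝ} {qb z : ℂ} (hqb : qb * conj qb = (q0 : ℂ) ^ 2)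
    (hg : gam q0 z ≠ 0) : eigY qb z * eigYInv q0 qb z = 1 := by
  have h : 1 - I / z * qb * (I / z * conj qb) = gam q0 z := by
    have hI := Complex.I_sq
    rw [gam, ← hqb, ← neg_neg (_ / z ^ 2), ← neg_one_mul, ← hI]
    ring
  rw [eigYInv, Matrix.mul_smul, eigY_eq]
  ext i j
  fin_cases i <;> fin_cases j <;>
    simp only [Matrix.smul_apply, Matrix.mul_apply, Fin.sum_univ_two] <;> simp
  · rw [← sub_eq_add_neg, h, inv_mul_cancel₀ hg]
  · rw [neg_add_eq_sub, mul_comm (I / z * conj qb), h, inv_mul_cancel₀ hg]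

/-- The columns of `eigY` are eigenvectors of the limit of `X`. -/
lemma eigY_mul_diagonal {q0 : ℝ} {qb z : ℂ} (hqb : qb * conj qb = (q0 : ℂ) ^ 2) (hz : z ≠ 0) :
    eigY qb z * Matrix.diagonal ![0, 2 * I * lamOf q0 z]
      = (!![-(I * kOf q0 z), qb; -conj qb, I * kOf q0 z] + (I * lamOf q0 z) • 1) * eigY qb z := by
  have hI := Complex.I_sq
  rw [eigY_eq]
  ext i j
  fin_cases i <;> fin_cases j <;>
    simp [Matrix.mul_apply, Fin.sum_univ_two, kOf, lamOf] <;> field_simp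
  · linear_combination 2 * I * hqb
  · linear_combination (-2 * qb * z ^ 2) * hI
  · linear_combination (2 * z ^ 2 * conj qb) * hI
  · linear_combination (-2 : ℂ) * hqb

/-- The limits of X and T share this eigenvector, with eigenvalues -iλ and -iλk. Hence the factor
e^{iθ} makes the limiting time flow stationary on it. -/
lemma laxTMat_mulVec_eigY {q0 : ℝ} {qb z : ℂ} (hqb : qb * conj qb = (q0 : ℂ) ^ 2) (hz : z ≠ 0) :
    (laxTMat q0 (kOf q0 z) qb 0 + (I * (lamOf q0 z * kOf q0 z)) • 1).mulVec
      (fun i => eigY qb z i 0) = 0 := by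
  have hI := Complex.I_sq
  rw [eigY_eq]
  ext i
  fin_cases i <;>
    simp [Matrix.mulVec, dotProduct, Fin.sum_univ_two, laxTMat, kOf, lamOf] <;> field_simp
  · linear_combination 2 * I * (q0 : ℂ) ^ 2 * hqb
  · linear_combination (-2 * conj qb * z ^ 4 + 2 * conj qb * z ^ 2 * (q0 : ℂ) ^ 2) * hI
      + 2 * conj qb * z ^ 2 * I ^ 2 * hqb

/-- The perturbation term `Y⁻¹ (Q - Q_b) Y`, as a linear function of `q - q_b`. -/
def perturbation (q0 : ℝ) (qb z : ℂ) : ℂ →ₗ[ℝ] ((Fin 2 → ℂ) →L[ℝ] (Fin 2 → ℂ)) where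
  toFun d := mulVecCLM (eigYInv q0 qb z * potMat d * eigY qb z)
  map_add' d e := by
    rw [← map_add, ← add_mul, ← mul_add]
    congr 3
    ext i j; fin_cases i <;> fin_cases j <;> simp [potMat]; ring
  map_smul' c d := by
    rw [← map_smul, RingHom.id_apply, ← Matrix.smul_mul, ← Matrix.mul_smul]
    congr 3
    ext i j; fin_cases i <;> fin_cases j <;> simp [potMat]

namespace IsPotential

variable {q0 : ℝ} {qm qp : ℂ} {q : ℝ → ℝ → ℂ}

/-- In the eigenbasis Y₊ and after removal of e^{-iλx}, the exponents are 0 and 2iλ. The latter has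
positive real part on D⁻, so the limit (1, 0) can be prescribed. -/
lemma exists_spatial_solution (hq : IsPotential q0 qm qp q) {z : ℂ} (hz : z ∈ DMinus q0) :
    ∃ φ : ℝ → Fin 2 → ℂ, (∀ x, HasDerivAt φ ((laxX q0 q z x 0).mulVec (φ x)) x) ∧
      Tendsto (fun x : ℝ => exp (I * (lamOf q0 z * x)) • φ x) atTop (𝓝 fun i => eigY qp z i 0) := by
  have hz0 := ne_zero_of_mem_DMinus hz
  have hYY := eigY_mul_eigYInv hq.mul_conj_qp (gam_ne_zero hz0 hq.q0_pos (norm_ne_of_mem_DMinus hz))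
  have hYD := eigY_mul_diagonal hq.mul_conj_qp hz0
  set Y := eigY qp z
  set l := lamOf q0 z with hl
  let L : ℂ →L[ℝ] ((Fin 2 → ℂ) →L[ℝ] (Fin 2 → ℂ)) :=
    LinearMap.toContinuousLinearMap (perturbation q0 qp z)
  have hqc : Continuous fun x => q x 0 - qp := (hq.contDiff_x 0).continuous.sub continuous_const
  have hint : IntegrableOn (fun x => ‖L (q x 0 - qp)‖) (Set.Ioi 0) :=
    (L.integrable_comp ((hq.integrable_qp 0).mono_set Set.Ioi_subset_Ici_self)).norm
  obtain ⟨w, hw, hwt⟩ := exists_solution_tendsto (ι := Fin 2) (μ := ![0, 2 * I * l])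
    (V := fun x => L (q x 0 - qp)) (w₀ := ![1, 0])
    (fun i => by
      have := im_lamOf_neg hz
      fin_cases i
      · simp
      · simp; linarith)
    (L.continuous.comp hqc) hint (fun i => by fin_cases i <;> simp)
  refine ⟨fun x => exp (-(I * (l * x))) • Y.mulVec (w x), fun x => ?_, ?_⟩
  · have h1 : HasDerivAt (fun x : ℝ => exp (-(I * (l * x)))) (-(I * l) * exp (-(I * (l * x)))) x := by
      have := (((hasDerivAt_id x).ofReal_comp.const_mul l).const_mul I).neg.cexp
      exact this.congr_deriv (by simp; ring)
    have h2 : HasDerivAt (fun x => Y.mulVec (w x)) _ x :=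
      (mulVecCLM Y).hasFDerivAt.comp_hasDerivAt x (hw x)
    refine (h1.smul h2).congr_deriv ?_
    have h3 : (fun i => (![0, 2 * I * l] : Fin 2 → ℂ) i * w x i + L (q x 0 - qp) (w x) i)
        = (Matrix.diagonal ![0, 2 * I * l]).mulVec (w x)
          + (eigYInv q0 qp z * potMat (q x 0 - qp) * Y).mulVec (w x) := by
      ext i
      rw [Pi.add_apply, Matrix.mulVec_diagonal]
      rfl
    have h4 : laxX q0 q z x 0 = !![-(I * kOf q0 z), qp; -conj qp, I * kOf q0 z]
        + potMat (q x 0 - qp) := by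
      rw [laxX_eq]
      ext i j; fin_cases i <;> fin_cases j <;> simp [potMat]
      ring
    rw [h3, mulVecCLM_apply, Matrix.mulVec_add, Matrix.mulVec_mulVec, Matrix.mulVec_mulVec, hYD,
      ← Matrix.mul_assoc, ← Matrix.mul_assoc, hYY, h4, Matrix.one_mul, Matrix.mulVec_smul,
      Matrix.mulVec_mulVec, add_mul, add_mul, Matrix.add_mulVec, Matrix.add_mulVec]
    simp only [Matrix.smul_mul, Matrix.one_mul, Matrix.smul_mulVec]
    module
  · have h1 : Tendsto (fun x => Y.mulVec (w x)) atTop (𝓝 (Y.mulVec ![1, 0])) :=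
      ((mulVecCLM Y).continuous.tendsto _).comp hwt
    have h2 : Y.mulVec ![1, 0] = fun i => Y i 0 := by
      ext i; simp [Matrix.mulVec, dotProduct, Fin.sum_univ_two]
    rw [h2] at h1
    convert h1 using 2 with x
    rw [smul_smul, ← Complex.exp_add, add_neg_cancel, Complex.exp_zero, one_smul]

lemma tendsto_laxT (hq : IsPotential q0 qm qp q) (z : ℂ) (t : ℝ) :
    Tendsto (fun p : ℝ × ℝ => laxT q0 q z p.1 p.2) (atTop ×ˢ 𝓝 t)
      (𝓝 (laxTMat q0 (kOf q0 z) qp 0)) := by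
  simp only [laxT_eq]
  have h := ((continuous_laxTMat q0 (kOf q0 z)).tendsto (qp, 0)).comp
    ((hq.tendsto_qp t).prodMk_nhds (hq.tendsto_qx_top t))
  exact h

lemma hasDerivAt_exp_theta (q0 : ℝ) (z : ℂ) (x t : ℝ) :
    HasDerivAt (fun t : ℝ => exp (I * theta q0 z x t))
      (I * (lamOf q0 z * kOf q0 z) * exp (I * theta q0 z x t)) t := by
  have := ((((hasDerivAt_id t).ofReal_comp.const_mul (kOf q0 z)).const_add (x : ℂ)).const_mul
    (lamOf q0 z)).const_mul I
  exact this.cexp.congr_deriv (by simp [theta]; ring)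

lemma exists_isJostColumn_plus (hq : IsPotential q0 qm qp q) {z : ℂ} (hz : z ∈ DMinus q0) :
    ∃ ψ, IsJostColumn q0 q atTop qp 0 z ψ := by
  obtain ⟨φ, hφ, hφt⟩ := hq.exists_spatial_solution hz
  have hXc : Continuous fun p : ℝ × ℝ =>
      mulVecCLM (potMat (deriv (fun s => q p.1 s) p.2)) := by
    refine continuous_mulVecCLM.comp (continuous_matrix fun i j => ?_)
    have h := hq.continuous_qt
    have h' : Continuous fun p : ℝ × ℝ => conj (deriv (fun s => q p.1 s) p.2) :=
      Complex.continuous_conj.comp h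
    fin_cases i <;> fin_cases j
    exacts [continuous_const, h, h'.neg, continuous_const]
  obtain ⟨ψ, hψ0, hψx, hψt⟩ := exists_simultaneous_solution
    (X := fun x t => mulVecCLM (laxX q0 q z x t)) (T := fun x t => mulVecCLM (laxT q0 q z x t))
    (hq.continuous_laxX z) hXc (hq.hasDerivAt_laxX z) (hq.hasDerivAt_laxT z)
    (hq.continuous_laxT_zero z)
    (fun x t v => by
      simp only [mulVecCLM_apply, Matrix.mulVec_mulVec, ← Matrix.add_mulVec]
      congr 1
      abel) hφ
  refine ⟨ψ, hψx, hψt, ?_⟩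
  simp only [sigma3, Matrix.of_apply, Matrix.cons_val_zero, mul_one]
  refine tendsto_of_hasDerivAt_time
    (S := fun x t => mulVecCLM (laxT q0 q z x t + (I * (lamOf q0 z * kOf q0 z)) • 1))
    (S₀ := mulVecCLM (laxTMat q0 (kOf q0 z) qp 0 + (I * (lamOf q0 z * kOf q0 z)) • 1))
    (f := fun x t => exp (I * theta q0 z x t) • ψ x t)
    (fun t => (continuous_mulVecCLM.tendsto _).comp ((hq.tendsto_laxT z t).add_const _))
    (laxTMat_mulVec_eigY hq.mul_conj_qp (ne_zero_of_mem_DMinus hz)) (fun x t => ?_) ?_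
  · refine ((hasDerivAt_exp_theta q0 z x t).smul (hψt x t)).congr_deriv ?_
    simp only [mulVecCLM_apply, Matrix.mulVec_smul, Matrix.add_mulVec, Matrix.smul_mulVec,
      Matrix.one_mulVec]
    module
  · simpa only [hψ0, theta, ofReal_zero, mul_zero, add_zero] using hφt

end IsPotential

/-! ### The involutions z ↦ -q₀²/z and z ↦ z*. -/

lemma kOf_inversion {q0 : ℝ} (hq0 : (q0 : ℂ) ≠ 0) {z : ℂ} (hz : z ≠ 0) :
    kOf q0 (-(q0 : ℂ) ^ 2 / z) = kOf q0 z := by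
  simp only [kOf]; field_simp; ring

lemma lamOf_inversion {q0 : ℝ} (hq0 : (q0 : ℂ) ≠ 0) {z : ℂ} (hz : z ≠ 0) :
    lamOf q0 (-(q0 : ℂ) ^ 2 / z) = -lamOf q0 z := by
  simp only [lamOf]; field_simp; ring

lemma theta_inversion {q0 : ℝ} (hq0 : (q0 : ℂ) ≠ 0) {z : ℂ} (hz : z ≠ 0) (x t : ℝ) :
    theta q0 (-(q0 : ℂ) ^ 2 / z) x t = -theta q0 z x t := by
  simp only [theta, kOf_inversion hq0 hz, lamOf_inversion hq0 hz]; ring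

lemma gam_inversion {q0 : ℝ} (hq0 : (q0 : ℂ) ≠ 0) {z : ℂ} (hz : z ≠ 0) :
    gam q0 (-(q0 : ℂ) ^ 2 / z) = z ^ 2 / (q0 : ℂ) ^ 2 * gam q0 z := by
  simp only [gam]; field_simp; ring

lemma kOf_conj (q0 : ℝ) (z : ℂ) : kOf q0 (conj z) = conj (kOf q0 z) := by simp [kOf, map_ofNat]

lemma lamOf_conj (q0 : ℝ) (z : ℂ) : lamOf q0 (conj z) = conj (lamOf q0 z) := by simp [lamOf, map_ofNat]

lemma theta_conj (q0 : ℝ) (z : ℂ) (x t : ℝ) : theta q0 (conj z) x t = conj (theta q0 z x t) := by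
  simp [theta, kOf_conj, lamOf_conj]

lemma gam_conj (q0 : ℝ) (z : ℂ) : gam q0 (conj z) = conj (gam q0 z) := by simp [gam]

lemma inversion_inversion {q0 : ℝ} (hq0 : (q0 : ℂ) ≠ 0) {z : ℂ} (hz : z ≠ 0) :
    -(q0 : ℂ) ^ 2 / (-(q0 : ℂ) ^ 2 / z) = z := by
  field_simp

lemma conj_inversion (q0 : ℝ) (z : ℂ) :
    conj (-(q0 : ℂ) ^ 2 / z) = -(q0 : ℂ) ^ 2 / conj z := by simp

lemma inversion_ne_zero {q0 : ℝ} (hq0 : (q0 : ℂ) ≠ 0) {z : ℂ} (hz : z ≠ 0) :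
    -(q0 : ℂ) ^ 2 / z ≠ 0 := div_ne_zero (neg_ne_zero.2 (pow_ne_zero 2 hq0)) hz

/-- In terms of λ the effect of the involutions on the regions is immediate: one conjugates λ, the
other negates it. -/
lemma mem_DMinus_iff {q0 : ℝ} {z : ℂ} : z ∈ DMinus q0 ↔ z ≠ 0 ∧ (lamOf q0 z).im < 0 := by
  refine ⟨fun h => ⟨ne_zero_of_mem_DMinus h, im_lamOf_neg h⟩, fun ⟨h0, h⟩ => ?_⟩
  have := norm_pos_iff.2 h0
  rw [im_lamOf, div_lt_iff₀ (by positivity), zero_mul] at h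
  exact h

lemma mem_DPlus_iff {q0 : ℝ} {z : ℂ} : z ∈ DPlus q0 ↔ z ≠ 0 ∧ 0 < (lamOf q0 z).im := by
  refine ⟨fun h => ⟨ne_zero_of_mem_DPlus h, im_lamOf_pos h⟩, fun ⟨h0, h⟩ => ?_⟩
  have := norm_pos_iff.2 h0
  rw [im_lamOf, lt_div_iff₀ (by positivity), zero_mul] at h
  exact h

lemma conj_mem_DPlus {q0 : ℝ} {z : ℂ} (h : z ∈ DMinus q0) : conj z ∈ DPlus q0 := by
  rw [mem_DMinus_iff] at h
  rw [mem_DPlus_iff, lamOf_conj]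
  simpa using h

lemma conj_mem_DMinus {q0 : ℝ} {z : ℂ} (h : z ∈ DPlus q0) : conj z ∈ DMinus q0 := by
  rw [mem_DPlus_iff] at h
  rw [mem_DMinus_iff, lamOf_conj]
  simpa using h

lemma inversion_mem_DPlus {q0 : ℝ} (hq0 : (q0 : ℂ) ≠ 0) {z : ℂ} (h : z ∈ DMinus q0) :
    -(q0 : ℂ) ^ 2 / z ∈ DPlus q0 := by
  rw [mem_DMinus_iff] at h
  rw [mem_DPlus_iff, lamOf_inversion hq0 h.1]
  exact ⟨inversion_ne_zero hq0 h.1, by simpa using h.2⟩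

lemma inversion_mem_DMinus {q0 : ℝ} (hq0 : (q0 : ℂ) ≠ 0) {z : ℂ} (h : z ∈ DPlus q0) :
    -(q0 : ℂ) ^ 2 / z ∈ DMinus q0 := by
  rw [mem_DPlus_iff] at h
  rw [mem_DMinus_iff, lamOf_inversion hq0 h.1]
  exact ⟨inversion_ne_zero hq0 h.1, by simpa using h.2⟩

lemma isOpen_DMinus (q0 : ℝ) : IsOpen (DMinus q0) :=
  isOpen_lt (((continuous_norm.pow 2).sub continuous_const).mul Complex.continuous_im)
    continuous_const

lemma isOpen_DPlus (q0 : ℝ) : IsOpen (DPlus q0) :=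
  isOpen_lt continuous_const
    (((continuous_norm.pow 2).sub continuous_const).mul Complex.continuous_im)

lemma tendsto_fin_two {l : Filter ℝ} {f : ℝ → Fin 2 → ℂ} {a : Fin 2 → ℂ} :
    Tendsto f l (𝓝 a) ↔ Tendsto (fun x => f x 0) l (𝓝 (a 0)) ∧
      Tendsto (fun x => f x 1) l (𝓝 (a 1)) := by
  rw [tendsto_pi_nhds, Fin.forall_fin_two]

lemma hasDerivAt_fin_two {f : ℝ → Fin 2 → ℂ} {a : Fin 2 → ℂ} {x : ℝ} :
    HasDerivAt f a x ↔ HasDerivAt (fun x => f x 0) (a 0) x ∧ HasDerivAt (fun x => f x 1) (a 1) x := by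
  rw [hasDerivAt_pi, Fin.forall_fin_two]

/-! ### Symmetries of Jost columns. -/

namespace IsJostColumn

variable {q0 : ℝ} {q : ℝ → ℝ → ℂ} {l l' : Filter ℝ} {qb z : ℂ} {ψ : ℝ → ℝ → Fin 2 → ℂ}

/-- X and T depend on z only through k, which the inversion fixes. The same function therefore
solves the new system; θ changes sign, which swaps the columns, and c corrects the normalization. -/
lemma smul_inversion (hq0 : (q0 : ℂ) ≠ 0) (hz : z ≠ 0) {j j' : Fin 2} {c : ℂ}
    (hψ : IsJostColumn q0 q l qb j z ψ) (hj : sigma3 j' j' = -sigma3 j j)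
    (hc : ∀ i, c * eigY qb z i j = eigY qb (-(q0 : ℂ) ^ 2 / z) i j') :
    IsJostColumn q0 q l qb j' (-(q0 : ℂ) ^ 2 / z) (fun x t => c • ψ x t) where
  eq_x x t := by
    refine ((hψ.eq_x x t).const_smul c).congr_deriv ?_
    rw [Matrix.mulVec_smul, laxX_eq, laxX_eq, kOf_inversion hq0 hz]
  eq_t x t := by
    refine ((hψ.eq_t x t).const_smul c).congr_deriv ?_
    rw [Matrix.mulVec_smul, laxT_eq, laxT_eq, kOf_inversion hq0 hz]
  asymptotic t := by
    have h := (hψ.asymptotic t).const_smul c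
    rw [show (c • fun i => eigY qb z i j) = fun i => eigY qb (-(q0 : ℂ) ^ 2 / z) i j' from
      funext hc] at h
    convert h using 2 with x
    rw [theta_inversion hq0 hz, hj, smul_comm]
    congr 3
    ring

/-- The symmetry `z ↦ -q₀²/z`, from the first column to the second. -/
lemma inversion_zero (hq0 : (q0 : ℂ) ≠ 0) (hz : z ≠ 0) (hqb : qb * conj qb = (q0 : ℂ) ^ 2)
    (hψ : IsJostColumn q0 q l qb 0 z ψ) :
    IsJostColumn q0 q l qb 1 (-(q0 : ℂ) ^ 2 / z) (fun x t => (I * z / conj qb) • ψ x t) := by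
  have hb : conj qb ≠ 0 := by
    rintro h; rw [h, mul_zero] at hqb; exact pow_ne_zero 2 hq0 hqb.symm
  refine hψ.smul_inversion hq0 hz (by simp [sigma3]) fun i => ?_
  have hI := Complex.I_sq
  rw [eigY_eq, eigY_eq]
  fin_cases i <;> simp <;> field_simp
  · linear_combination -hqb
  · linear_combination -hI

/-- The symmetry `z ↦ -q₀²/z`, from the second column to the first. -/
lemma inversion_one (hq0 : (q0 : ℂ) ≠ 0) (hz : z ≠ 0) (hqb : qb * conj qb = (q0 : ℂ) ^ 2)
    (hψ : IsJostColumn q0 q l qb 1 z ψ) :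
    IsJostColumn q0 q l qb 0 (-(q0 : ℂ) ^ 2 / z) (fun x t => (I * z / qb) • ψ x t) := by
  have hb : qb ≠ 0 := by
    rintro h; rw [h, zero_mul] at hqb; exact pow_ne_zero 2 hq0 hqb.symm
  refine hψ.smul_inversion hq0 hz (by simp [sigma3]) fun i => ?_
  have hI := Complex.I_sq
  rw [eigY_eq, eigY_eq]
  fin_cases i <;> simp <;> field_simp
  · linear_combination -hI
  · linear_combination -hqb

/-- With J the antisymmetric matrix with rows (0, 1) and (-1, 0), J X(z)* J⁻¹ = X(z*), where * is
entrywise conjugation, and likewise for T. -/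
lemma conj_smul {j j' : Fin 2} (hψ : IsJostColumn q0 q l qb j z ψ)
    (hj : sigma3 j' j' = -sigma3 j j) (hjc : conj (sigma3 j j) = sigma3 j j) {c : ℂ}
    (hc0 : c * conj (eigY qb z 1 j) = eigY qb (conj z) 0 j')
    (hc1 : -c * conj (eigY qb z 0 j) = eigY qb (conj z) 1 j') :
    IsJostColumn q0 q l qb j' (conj z)
      (fun x t => ![c * conj (ψ x t 1), -c * conj (ψ x t 0)]) where
  eq_x x t := by
    obtain ⟨h0, h1⟩ := hasDerivAt_fin_two.1 (hψ.eq_x x t)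
    refine hasDerivAt_fin_two.2 ⟨((hasDerivAt_conj h1).const_mul c).congr_deriv ?_,
      ((hasDerivAt_conj h0).const_mul (-c)).congr_deriv ?_⟩
    all_goals
      rw [laxX_eq, laxX_eq]
      simp [Matrix.mulVec, dotProduct, Fin.sum_univ_two, kOf_conj]
      ring
  eq_t x t := by
    obtain ⟨h0, h1⟩ := hasDerivAt_fin_two.1 (hψ.eq_t x t)
    refine hasDerivAt_fin_two.2 ⟨((hasDerivAt_conj h1).const_mul c).congr_deriv ?_,
      ((hasDerivAt_conj h0).const_mul (-c)).congr_deriv ?_⟩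
    all_goals
      rw [laxT_eq, laxT_eq]
      simp [Matrix.mulVec, dotProduct, Fin.sum_univ_two, kOf_conj, laxTMat, map_ofNat]
      ring
  asymptotic t := by
    obtain ⟨h0, h1⟩ := tendsto_fin_two.1 (hψ.asymptotic t)
    have e : ∀ x : ℝ, exp (I * theta q0 (conj z) x t * sigma3 j' j')
        = conj (exp (I * theta q0 z x t * sigma3 j j)) := fun x => by
      rw [← Complex.exp_conj, theta_conj, hj]
      simp [hjc]
    refine tendsto_fin_two.2 ⟨?_, ?_⟩
    · rw [← hc0]
      refine (((Complex.continuous_conj.tendsto _).comp h1).const_mul c).congr fun x => ?_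
      simp only [Function.comp_apply, Pi.smul_apply, smul_eq_mul, map_mul, e, Matrix.cons_val_zero]
      ring
    · rw [← hc1]
      refine (((Complex.continuous_conj.tendsto _).comp h0).const_mul (-c)).congr fun x => ?_
      simp only [Function.comp_apply, Pi.smul_apply, smul_eq_mul, map_mul, e, Matrix.cons_val_one,
        Matrix.cons_val_fin_one]
      ring

/-- The symmetry `z ↦ z*`, from the first column to the second. -/
lemma conj_zero (hψ : IsJostColumn q0 q l qb 0 z ψ) :
    IsJostColumn q0 q l qb 1 (conj z) (fun x t => ![-conj (ψ x t 1), conj (ψ x t 0)]) := by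
  have := hψ.conj_smul (j' := 1) (c := -1) (by simp [sigma3]) (by simp [sigma3])
    (by simp [eigY_eq, neg_div]) (by simp [eigY_eq])
  simpa using this

/-- The symmetry `z ↦ z*`, from the second column to the first. -/
lemma conj_one (hψ : IsJostColumn q0 q l qb 1 z ψ) :
    IsJostColumn q0 q l qb 0 (conj z) (fun x t => ![conj (ψ x t 1), -conj (ψ x t 0)]) := by
  have := hψ.conj_smul (j' := 0) (c := 1) (by simp [sigma3]) (by simp [sigma3])
    (by simp [eigY_eq]) (by simp [eigY_eq, neg_div])
  simpa using this

end IsJostColumn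

/-! ### Exchange of the two ends of the line. -/

/-- The potential `q*(-x,-t)`. -/
def reflect (q : ℝ → ℝ → ℂ) (x t : ℝ) : ℂ := conj (q (-x) (-t))

@[simp]
lemma reflect_reflect (q : ℝ → ℝ → ℂ) : reflect (reflect q) = q := by
  ext x t; simp [reflect]

lemma deriv_conj_neg (f : ℝ → ℂ) (x : ℝ) :
    deriv (fun y => conj (f (-y))) x = -conj (deriv f (-x)) := by
  have h : deriv (fun y => conj (f (-y))) x = conj (deriv (fun y => f (-y)) x) :=
    deriv.star
  rw [h, deriv_comp_neg, map_neg]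

/-- Swapping the two components conjugates -X(-x,-t) and -T(-x,-t) into the Lax matrices of the
reflected potential at the same z, while θ is odd in (x, t). This reduces ψ_{-,2} to ψ_{+,1}. -/
lemma IsJostColumn.reflect {q0 : ℝ} {q : ℝ → ℝ → ℂ} {l l' : Filter ℝ} {qb z : ℂ}
    {ψ : ℝ → ℝ → Fin 2 → ℂ} (hl : Tendsto (fun x : ℝ => -x) l' l)
    (hψ : IsJostColumn q0 q l qb 0 z ψ) :
    IsJostColumn q0 (reflect q) l' (conj qb) 1 z
      (fun x t => ![ψ (-x) (-t) 1, ψ (-x) (-t) 0]) where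
  eq_x x t := by
    have h := (hψ.eq_x (-x) (-t)).scomp x (hasDerivAt_neg x)
    obtain ⟨h0, h1⟩ := hasDerivAt_fin_two.1 h
    refine hasDerivAt_fin_two.2 ⟨h1.congr_deriv ?_, h0.congr_deriv ?_⟩
    all_goals
      rw [laxX_eq, laxX_eq]
      simp [Matrix.mulVec, dotProduct, Fin.sum_univ_two, KE.reflect]
      try ring
  eq_t x t := by
    have h := (hψ.eq_t (-x) (-t)).scomp t (hasDerivAt_neg t)
    obtain ⟨h0, h1⟩ := hasDerivAt_fin_two.1 h
    have hd : deriv (fun y => KE.reflect q y t) x = -conj (deriv (fun y => q y (-t)) (-x)) :=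
      deriv_conj_neg (fun y => q y (-t)) x
    refine hasDerivAt_fin_two.2 ⟨h1.congr_deriv ?_, h0.congr_deriv ?_⟩
    all_goals
      rw [laxT_eq, laxT_eq, hd]
      simp [Matrix.mulVec, dotProduct, Fin.sum_univ_two, KE.reflect, laxTMat]
      ring
  asymptotic t := by
    obtain ⟨h0, h1⟩ := tendsto_fin_two.1 ((hψ.asymptotic (-t)).comp hl)
    have e : ∀ x : ℝ, I * theta q0 z (-x) (-t) * sigma3 0 0 = I * theta q0 z x t * sigma3 1 1 :=
      fun x => by simp [theta, sigma3]; ring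
    simp only [Function.comp_apply, e] at h0 h1
    refine tendsto_fin_two.2 ⟨?_, ?_⟩
    · rw [eigY_eq] at h1 ⊢
      simpa using h1
    · rw [eigY_eq] at h0 ⊢
      simpa using h0

lemma integrableOn_conj_neg {f : ℝ → ℂ} {s s' : Set ℝ} (hf : IntegrableOn f s)
    (hs : MeasurableSet s) (hs' : MeasurableSet s') (h : ∀ x, -x ∈ s ↔ x ∈ s') :
    IntegrableOn (fun x => conj (f (-x))) s' := by
  rw [← integrable_indicator_iff hs] at hf
  rw [← integrable_indicator_iff hs']
  have h1 : Integrable fun x => conj (s.indicator f (-x)) :=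
    Complex.conjCLE.toContinuousLinearMap.integrable_comp hf.comp_neg
  refine h1.congr (Filter.Eventually.of_forall fun x => ?_)
  by_cases hx : x ∈ s'
  · simp [hx, (h x).2 hx]
  · simp [hx, mt (h x).1 hx]

/-- Conjugation compensates for the reversal of t in the equation, and x ↦ -x exchanges the boundary
values. -/
lemma IsPotential.reflect {q0 : ℝ} {qm qp : ℂ} {q : ℝ → ℝ → ℂ} (hq : IsPotential q0 qm qp q) :
    IsPotential q0 (conj qp) (conj qm) (reflect q) := by
  have hdx : ∀ t, deriv (fun y => KE.reflect q y t)
      = fun x => -conj (deriv (fun y => q y (-t)) (-x)) := fun t =>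
    funext fun x => deriv_conj_neg (fun y => q y (-t)) x
  have hdt : ∀ x t, deriv (fun s => KE.reflect q x s) t = -conj (deriv (fun s => q (-x) s) (-t)) :=
    fun x t => deriv_conj_neg (fun s => q (-x) s) t
  have hdxx : ∀ x t, iteratedDeriv 2 (fun y => KE.reflect q y t) x
      = conj (iteratedDeriv 2 (fun y => q y (-t)) (-x)) := fun x t => by
    rw [iteratedDeriv_succ, iteratedDeriv_one, iteratedDeriv_succ, iteratedDeriv_one, hdx]
    have := deriv_conj_neg (deriv fun y => q y (-t)) x
    rw [deriv.fun_neg, this, neg_neg]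
  have hneg : Continuous fun p : ℝ × ℝ => (-p.1, -p.2) := by fun_prop
  have htop : ∀ t : ℝ, Tendsto (fun p : ℝ × ℝ => (-p.1, -p.2)) (atTop ×ˢ 𝓝 t) (atBot ×ˢ 𝓝 (-t)) :=
    fun t => tendsto_neg_atTop_atBot.prodMap (continuous_neg.tendsto t)
  have hbot : ∀ t : ℝ, Tendsto (fun p : ℝ × ℝ => (-p.1, -p.2)) (atBot ×ˢ 𝓝 t) (atTop ×ˢ 𝓝 (-t)) :=
    fun t => tendsto_neg_atBot_atTop.prodMap (continuous_neg.tendsto t)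
  have hc := Complex.continuous_conj
  constructor
  · exact hq.q0_pos
  · simpa using hq.norm_qp
  · simpa using hq.norm_qm
  · exact fun t => Complex.conjCLE.contDiff.comp ((hq.contDiff_x (-t)).comp contDiff_neg)
  · exact fun x => Complex.conjCLE.contDiff.comp ((hq.contDiff_t (-x)).comp contDiff_neg)
  · exact hc.comp (hq.continuous_q.comp hneg)
  · simp only [hdx]
    have := (hc.comp (hq.continuous_qx.comp hneg)).neg
    exact this
  · simp only [hdxx]
    have := hc.comp (hq.continuous_qxx.comp hneg)
    exact this
  · simp only [hdt]
    have := (hc.comp (hq.continuous_qt.comp hneg)).neg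
    exact this
  · intro x t
    have := congrArg conj (hq.equation (-x) (-t))
    simp only [map_add, map_mul, map_sub, map_pow, map_div₀, conj_I, conj_ofReal, map_ofNat,
      map_zero] at this
    rw [hdt, hdxx, show ‖KE.reflect q x t‖ = ‖q (-x) (-t)‖ by simp [KE.reflect], KE.reflect]
    linear_combination this
  · exact fun t => (hc.tendsto _).comp ((hq.tendsto_qm (-t)).comp (htop t))
  · exact fun t => (hc.tendsto _).comp ((hq.tendsto_qp (-t)).comp (hbot t))
  · intro t
    simp only [hdx]
    have := ((hc.tendsto _).comp ((hq.tendsto_qx_bot (-t)).comp (htop t))).neg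
    rw [map_zero, neg_zero] at this
    exact this
  · intro t
    simp only [hdx]
    have := ((hc.tendsto _).comp ((hq.tendsto_qx_top (-t)).comp (hbot t))).neg
    rw [map_zero, neg_zero] at this
    exact this
  · intro t
    have := integrableOn_conj_neg (hq.integrable_qm (-t)) measurableSet_Iic measurableSet_Ici
      (s' := Set.Ici 0) (by simp)
    simpa [KE.reflect] using this
  · intro t
    have := integrableOn_conj_neg (hq.integrable_qp (-t)) measurableSet_Ici measurableSet_Iic
      (s' := Set.Iic 0) (by simp)
    simpa [KE.reflect] using this

/-! ### Wronskians. -/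

lemma wronskian_smul_left (c : ℂ) (u v : Fin 2 → ℂ) : wronskian (c • u) v = c * wronskian u v := by
  simp [wronskian]; ring

lemma wronskian_smul_right (c : ℂ) (u v : Fin 2 → ℂ) : wronskian u (c • v) = c * wronskian u v := by
  simp [wronskian]; ring

lemma wronskian_comm (u v : Fin 2 → ℂ) : wronskian v u = -wronskian u v := by
  simp only [wronskian]; ring

lemma wronskian_self (u : Fin 2 → ℂ) : wronskian u u = 0 := by
  simp [wronskian, mul_comm]

lemma norm_wronskian_le (u v : Fin 2 → ℂ) : ‖wronskian u v‖ ≤ 2 * ‖u‖ * ‖v‖ := by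
  have h0 : ‖u 0 * v 1‖ ≤ ‖u‖ * ‖v‖ := by
    rw [norm_mul]; gcongr <;> exact norm_le_pi_norm _ _
  have h1 : ‖u 1 * v 0‖ ≤ ‖u‖ * ‖v‖ := by
    rw [norm_mul]; gcongr <;> exact norm_le_pi_norm _ _
  rw [wronskian]
  linarith [norm_sub_le (u 0 * v 1) (u 1 * v 0)]

lemma exists_smul_of_wronskian_eq_zero {u v : Fin 2 → ℂ} (hv : v ≠ 0) (h : wronskian u v = 0) :
    ∃ c : ℂ, u = c • v := by
  rw [wronskian] at h
  by_cases h0 : v 0 = 0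
  · have h1 : v 1 ≠ 0 := fun h1 => hv (by ext i; fin_cases i <;> simpa)
    refine ⟨u 1 / v 1, ?_⟩
    ext i
    fin_cases i
    · simp [h0] at h ⊢
      exact h.resolve_right h1
    · simp [h1]
  · refine ⟨u 0 / v 0, ?_⟩
    ext i
    fin_cases i
    · simp [h0]
    · simp
      field_simp
      linear_combination -h

/-- Abel's formula: the coefficient matrix has trace zero. -/
lemma wronskian_const {M : ℝ → Matrix (Fin 2) (Fin 2) ℂ} (hM : ∀ x, M x 1 1 = -M x 0 0)
    {u v : ℝ → Fin 2 → ℂ} (hu : ∀ x, HasDerivAt u ((M x).mulVec (u x)) x)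
    (hv : ∀ x, HasDerivAt v ((M x).mulVec (v x)) x) (a b : ℝ) :
    wronskian (u a) (v a) = wronskian (u b) (v b) := by
  have h : ∀ x, HasDerivAt (fun x => wronskian (u x) (v x)) 0 x := fun x => by
    obtain ⟨u0, u1⟩ := hasDerivAt_fin_two.1 (hu x)
    obtain ⟨v0, v1⟩ := hasDerivAt_fin_two.1 (hv x)
    refine ((u0.mul v1).sub (u1.mul v0)).congr_deriv ?_
    simp only [Matrix.mulVec, dotProduct, Fin.sum_univ_two, hM]
    ring
  exact is_const_of_deriv_eq_zero (fun x => (h x).differentiableAt) (fun x => (h x).deriv) a b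

lemma wronskian_spatial_const {q0 : ℝ} {q : ℝ → ℝ → ℂ} {z : ℂ} {t : ℝ} {u v : ℝ → Fin 2 → ℂ}
    (hu : ∀ x, HasDerivAt u ((laxX q0 q z x t).mulVec (u x)) x)
    (hv : ∀ x, HasDerivAt v ((laxX q0 q z x t).mulVec (v x)) x) (a b : ℝ) :
    wronskian (u a) (v a) = wronskian (u b) (v b) :=
  wronskian_const (fun x => by simp [laxX_eq]) hu hv a b

lemma eigY_diag (qb z : ℂ) (j : Fin 2) : eigY qb z j j = 1 := by
  rw [eigY_eq]; fin_cases j <;> rfl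

lemma eigY_col_ne_zero (qb z : ℂ) (j : Fin 2) : (fun i => eigY qb z i j) ≠ 0 := fun h => by
  simpa [eigY_diag] using congrFun h j

lemma IsPotential.spatial_unique {q0 : ℝ} {qm qp : ℂ} {q : ℝ → ℝ → ℂ}
    (hq : IsPotential q0 qm qp q) {z : ℂ} {t : ℝ} {u v : ℝ → Fin 2 → ℂ}
    (hu : ∀ x, HasDerivAt u ((laxX q0 q z x t).mulVec (u x)) x)
    (hv : ∀ x, HasDerivAt v ((laxX q0 q z x t).mulVec (v x)) x) {a : ℝ} (h : u a = v a) (b : ℝ) :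
    u b = v b := by
  have hc := (hq.continuous_laxX z).comp (continuous_id.prodMk (continuous_const (y := t)))
  exact linear_ode_unique (A := fun x => mulVecCLM (laxX q0 q z x t)) hc hu hv h b

/-! ### Decay, uniqueness and square integrable solutions. -/

namespace IsJostColumn

variable {q0 : ℝ} {qm qp : ℂ} {q : ℝ → ℝ → ℂ} {l : Filter ℝ} {qb z : ℂ} {j : Fin 2}
  {ψ χ : ℝ → ℝ → Fin 2 → ℂ}

lemma wronskian_eq {l' : Filter ℝ} {qb' : ℂ} {j' : Fin 2} (hψ : IsJostColumn q0 q l qb j z ψ)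
    (hχ : IsJostColumn q0 q l' qb' j' z χ) (x t : ℝ) :
    wronskian (ψ x t) (χ x t) = wronskian (ψ 0 0) (χ 0 0) :=
  (wronskian_spatial_const (fun x => hψ.eq_x x t) (fun x => hχ.eq_x x t) x 0).trans
    (wronskian_const (M := fun t => laxT q0 q z 0 t)
      (fun t => by simp [laxT_eq, laxTMat]; ring) (hψ.eq_t 0) (hχ.eq_t 0) t 0)

/-- Simultaneous solutions are determined by their value at the origin. -/
lemma eq_smul_of_eq_zero {l' : Filter ℝ} {qb' : ℂ} {j' : Fin 2} (hq : IsPotential q0 qm qp q)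
    (hψ : IsJostColumn q0 q l qb j z ψ) (hχ : IsJostColumn q0 q l' qb' j' z χ) {c : ℂ}
    (h : ψ 0 0 = c • χ 0 0) (x t : ℝ) : ψ x t = c • χ x t := by
  have h0 : ψ 0 t = c • χ 0 t :=
    linear_ode_unique (A := fun t => mulVecCLM (laxT q0 q z 0 t)) (g := fun t => c • χ 0 t)
      (hq.continuous_laxT_zero z) (hψ.eq_t 0)
      (fun t => ((hχ.eq_t 0 t).const_smul c).congr_deriv (by simp [Matrix.mulVec_smul])) h t
  exact hq.spatial_unique (v := fun x => c • χ x t) (fun x => hψ.eq_x x t)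
    (fun x => ((hχ.eq_x x t).const_smul c).congr_deriv (by simp [Matrix.mulVec_smul])) h0 x

/-- A zero would propagate to all x, against the diagonal entry 1 of the limiting column. -/
lemma ne_zero [l.NeBot] (hq : IsPotential q0 qm qp q) (hψ : IsJostColumn q0 q l qb j z ψ)
    (x t : ℝ) : ψ x t ≠ 0 := fun h => by
  have h0 : ∀ y, ψ y t = 0 := fun y =>
    hq.spatial_unique (v := fun _ => 0) (fun x => hψ.eq_x x t)
      (fun x => (hasDerivAt_const x (0 : Fin 2 → ℂ)).congr_deriv (by simp)) h y
  have h1 := hψ.asymptotic t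
  simp only [h0, smul_zero] at h1
  exact eigY_col_ne_zero qb z j (tendsto_nhds_unique h1 tendsto_const_nhds)

lemma isBigO (hψ : IsJostColumn q0 q l qb j z ψ) {s : ℝ} (hs : sigma3 j j = s) (t : ℝ) :
    (fun x => ψ x t) =O[l] fun x => Real.exp (s * (lamOf q0 z).im * x) := by
  have h1 := (hψ.asymptotic t).isBigO_one ℝ
  have h2 : (fun x : ℝ => exp (-(I * theta q0 z x t * sigma3 j j)))
      =O[l] fun x => Real.exp (s * (lamOf q0 z).im * x) := by
    refine Asymptotics.IsBigO.of_bound (Real.exp (s * (lamOf q0 z * kOf q0 z).im * t))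
      (Filter.Eventually.of_forall fun x => le_of_eq ?_)
    rw [Complex.norm_exp, Real.norm_of_nonneg (Real.exp_pos _).le, ← Real.exp_add, hs]
    congr 1
    simp [theta]
    ring
  have h3 := h2.smul h1
  simpa [smul_smul, ← Complex.exp_add] using h3

lemma tendsto_zero (hψ : IsJostColumn q0 q l qb j z ψ) {s : ℝ} (hs : sigma3 j j = s)
    (hl : Tendsto (fun x => s * (lamOf q0 z).im * x) l atBot) (t : ℝ) :
    Tendsto (fun x => ψ x t) l (𝓝 0) :=
  (hψ.isBigO hs t).trans_tendsto (Real.tendsto_exp_atBot.comp hl)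

/-- The Wronskian of two decaying solutions is constant and tends to 0, so they are proportional;
the diagonal entry 1 of the limit fixes the factor. -/
lemma unique [l.NeBot] (hq : IsPotential q0 qm qp q) {s : ℝ} (hs : sigma3 j j = s)
    (hl : Tendsto (fun x => s * (lamOf q0 z).im * x) l atBot)
    (hψ : IsJostColumn q0 q l qb j z ψ) (hχ : IsJostColumn q0 q l qb j z χ) : ψ = χ := by
  have hw : wronskian (ψ 0 0) (χ 0 0) = 0 := by
    have h1 : Tendsto (fun x => 2 * ‖ψ x 0‖ * ‖χ x 0‖) l (𝓝 0) := by
      simpa using ((hψ.tendsto_zero hs hl 0).norm.const_mul 2).mul (hχ.tendsto_zero hs hl 0).norm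
    have h2 : Tendsto (fun x => wronskian (ψ x 0) (χ x 0)) l (𝓝 0) :=
      squeeze_zero_norm (fun x => norm_wronskian_le _ _) h1
    simp only [hψ.wronskian_eq hχ _ 0] at h2
    exact tendsto_nhds_unique tendsto_const_nhds h2
  obtain ⟨c, hc⟩ := exists_smul_of_wronskian_eq_zero (hχ.ne_zero hq 0 0) hw
  have h := hψ.eq_smul_of_eq_zero hq hχ hc
  have h1 := hψ.asymptotic 0
  have h2 := (hχ.asymptotic 0).const_smul c
  simp only [h, smul_comm _ c] at h1
  have h3 := congrFun (tendsto_nhds_unique h1 h2) j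
  simp only [eigY_diag, Pi.smul_apply, smul_eq_mul, mul_one] at h3
  ext x t : 2
  rw [h, ← h3, one_smul]

/-- Square integrable solutions are multiples of a decaying Jost column. -/
lemma exists_eq_smul_of_memLp [l.NeBot] (hq : IsPotential q0 qm qp q)
    (hvol : ∀ S ∈ l, volume S = ⊤) (hψ : IsJostColumn q0 q l qb j z ψ) {t : ℝ}
    (h0 : Tendsto (fun x => ψ x t) l (𝓝 0)) {φ : ℝ → Fin 2 → ℂ}
    (hφ : ∀ x, HasDerivAt φ ((laxX q0 q z x t).mulVec (φ x)) x)
    (hL : ∀ i, MemLp (fun x => φ x i) 2 volume) : ∃ c : ℂ, ∀ x, φ x = c • ψ x t := by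
  have hw : wronskian (φ 0) (ψ 0 t) = 0 := by
    -- If the constant Wronskian w were non-zero, then once ‖ψ‖ < 1 one would have ‖φ‖ ≥ |w|/2. Such
    -- points fill a neighbourhood of the end, of infinite measure, which Markov's inequality
    -- excludes for φ in L².
    by_contra hne
    have hc := wronskian_spatial_const hφ (fun x => hψ.eq_x x t)
    set w := wronskian (φ 0) (ψ 0 t) with hwdef
    have hpos : 0 < ‖w‖ := norm_pos_iff.2 hne
    have h1 : Integrable fun x => ‖φ x 0‖ ^ 2 + ‖φ x 1‖ ^ 2 :=
      ((memLp_two_iff_integrable_sq_norm (hL 0).1).1 (hL 0)).add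
        ((memLp_two_iff_integrable_sq_norm (hL 1).1).1 (hL 1))
    have h2 := h1.measure_norm_ge_lt_top (ε := (‖w‖ / 2) ^ 2) (by positivity)
    refine h2.ne (hvol _ ?_)
    filter_upwards [h0.norm.eventually_lt_const (u := 1) (by simp)] with x hx
    have h3 : ‖w‖ ≤ 2 * ‖φ x‖ * ‖ψ x t‖ := by
      rw [hwdef, hc 0 x]; exact norm_wronskian_le _ _
    have h4 : ‖w‖ / 2 ≤ ‖φ x‖ := by nlinarith [norm_nonneg (φ x), norm_nonneg (ψ x t)]
    have h5 : ‖φ x‖ ^ 2 ≤ ‖φ x 0‖ ^ 2 + ‖φ x 1‖ ^ 2 := by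
      obtain ⟨i, hi⟩ : ∃ i, ‖φ x i‖ = ‖φ x‖ := by
        obtain ⟨i, hi⟩ := Finite.exists_max (fun i => ‖φ x i‖)
        exact ⟨i, le_antisymm (norm_le_pi_norm _ i)
          ((pi_norm_le_iff_of_nonneg (norm_nonneg _)).2 hi)⟩
      rw [← hi]
      fin_cases i
      · simp
      · simp
    change _ ≤ ‖_‖
    rw [Real.norm_of_nonneg (by positivity)]
    exact le_trans (by gcongr) h5
  obtain ⟨c, hc⟩ := exists_smul_of_wronskian_eq_zero (hψ.ne_zero hq 0 t) hw
  exact ⟨c, fun x => hq.spatial_unique (v := fun x => c • ψ x t) hφ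
    (fun x => ((hψ.eq_x x t).const_smul c).congr_deriv (by simp [Matrix.mulVec_smul])) hc x⟩

end IsJostColumn

lemma volume_eq_top_of_mem_atTop : ∀ S ∈ (atTop : Filter ℝ), volume S = ⊤ := fun S hS => by
  obtain ⟨a, ha⟩ := mem_atTop_sets.1 hS
  exact measure_mono_top (fun x hx => ha x hx) (Real.volume_Ici (a := a))

lemma volume_eq_top_of_mem_atBot : ∀ S ∈ (atBot : Filter ℝ), volume S = ⊤ := fun S hS => by
  obtain ⟨a, ha⟩ := mem_atBot_sets.1 hS
  exact measure_mono_top (fun x hx => ha x hx) (Real.volume_Iic (a := a))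

/-- There is a square integrable solution of the scattering problem if and only if the Wronskian of
the decaying Jost columns vanishes. -/
lemma exists_memLp_iff_wronskian_eq_zero {q0 : ℝ} {qm qp : ℂ} {q : ℝ → ℝ → ℂ} {z : ℂ}
    {ψ χ : ℝ → ℝ → Fin 2 → ℂ} {j j' : Fin 2} (hq : IsPotential q0 qm qp q)
    (hψ : IsJostColumn q0 q atTop qp j z ψ) (hχ : IsJostColumn q0 q atBot qm j' z χ) {s s' : ℝ}
    (hs : sigma3 j j = s) (hs' : sigma3 j' j' = s') (hneg : s * (lamOf q0 z).im < 0)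
    (hpos : 0 < s' * (lamOf q0 z).im) (t : ℝ) :
    (∃ φ : ℝ → Fin 2 → ℂ, φ ≠ 0 ∧ (∀ x, HasDerivAt φ ((laxX q0 q z x t).mulVec (φ x)) x) ∧
      ∀ i, MemLp (fun x => φ x i) 2 volume) ↔ wronskian (ψ 0 0) (χ 0 0) = 0 := by
  constructor
  · rintro ⟨φ, hφ0, hφ, hL⟩
    obtain ⟨c, hc⟩ := hψ.exists_eq_smul_of_memLp hq volume_eq_top_of_mem_atTop
      (hψ.tendsto_zero hs (tendsto_id.const_mul_atTop_of_neg hneg) t) hφ hL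
    obtain ⟨d, hd⟩ := hχ.exists_eq_smul_of_memLp hq volume_eq_top_of_mem_atBot
      (hχ.tendsto_zero hs' (tendsto_id.const_mul_atBot hpos) t) hφ hL
    have hc0 : c ≠ 0 := by
      rintro rfl
      exact hφ0 (funext fun x => by simp [hc])
    have h : c * wronskian (ψ 0 t) (χ 0 t) = 0 := by
      rw [← wronskian_smul_left, ← hc, hd, wronskian_smul_left, wronskian_self, mul_zero]
    rw [← hψ.wronskian_eq hχ 0 t]
    exact (mul_eq_zero.1 h).resolve_left hc0
  · intro hw
    obtain ⟨c, hc⟩ := exists_smul_of_wronskian_eq_zero (hχ.ne_zero hq 0 0) hw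
    have h := hψ.eq_smul_of_eq_zero hq hχ hc
    refine ⟨fun x => ψ x t, fun h0 => hψ.ne_zero hq 0 t (congrFun h0 0), fun x => hψ.eq_x x t,
      fun i => ?_⟩
    have hcont : Continuous fun x => ψ x t i := (continuous_apply i).comp
      (continuous_iff_continuousAt.2 fun x => (hψ.eq_x x t).continuousAt)
    rw [memLp_two_iff_integrable_sq_norm hcont.aestronglyMeasurable]
    have happ : ∀ l : Filter ℝ, (fun x => ψ x t i) =O[l] fun x => ψ x t := fun l =>
      Asymptotics.isBigO_of_le l fun x => norm_le_pi_norm _ i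
    have hsq : ∀ (l : Filter ℝ) (a : ℝ), ((fun x => ψ x t) =O[l] fun x => Real.exp (a * x)) →
        (fun x => ‖ψ x t i‖ ^ 2) =O[l] fun x => Real.exp (2 * a * x) := fun l a ha => by
      refine ((((happ l).trans ha).norm_left).pow 2).congr_right fun x => ?_
      rw [← Real.exp_nat_mul]
      congr 1
      push_cast
      ring
    have h1 := hsq _ _ (hψ.isBigO hs t)
    -- Proportionality transfers to ψ the decay of χ at the opposite end.
    have h2 : (fun x => ψ x t) =O[atBot] fun x => Real.exp (s' * (lamOf q0 z).im * x) := by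
      simp only [h]
      exact (hχ.isBigO hs' t).const_smul_left c
    refine (hcont.norm.pow 2).locallyIntegrable.integrable_of_isBigO_atBot_atTop (hsq _ _ h2)
      ⟨Set.Iic 0, Iic_mem_atBot 0, integrableOn_exp_mul_Iic (by linarith) 0⟩ h1
      ⟨Set.Ioi 0, Ioi_mem_atTop 0, integrableOn_exp_mul_Ioi (by linarith) 0⟩

/-! ### Jost functions, s₁₁ and s₂₂, and the norming constants. -/

namespace IsPotential

variable {q0 : ℝ} {qm qp : ℂ} {q : ℝ → ℝ → ℂ} {z : ℂ}

lemma exists_isJostColumn_minus (hq : IsPotential q0 qm qp q) (hz : z ∈ DMinus q0) :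
    ∃ ψ, IsJostColumn q0 q atBot qm 1 z ψ := by
  obtain ⟨ψ, hψ⟩ := hq.reflect.exists_isJostColumn_plus hz
  have := hψ.reflect tendsto_neg_atBot_atTop
  rw [reflect_reflect, conj_conj] at this
  exact ⟨_, this⟩

lemma existsUnique_plus_zero (hq : IsPotential q0 qm qp q) (hz : z ∈ DMinus q0) :
    ∃! ψ, IsJostColumn q0 q atTop qp 0 z ψ := by
  obtain ⟨ψ, hψ⟩ := hq.exists_isJostColumn_plus hz
  have := im_lamOf_neg hz
  exact ⟨ψ, hψ, fun χ hχ => hχ.unique hq (s := 1) (by simp [sigma3])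
    (tendsto_id.const_mul_atTop_of_neg (by linarith)) hψ⟩

lemma existsUnique_minus_one (hq : IsPotential q0 qm qp q) (hz : z ∈ DMinus q0) :
    ∃! ψ, IsJostColumn q0 q atBot qm 1 z ψ := by
  obtain ⟨ψ, hψ⟩ := hq.exists_isJostColumn_minus hz
  have := im_lamOf_neg hz
  exact ⟨ψ, hψ, fun χ hχ => hχ.unique hq (s := -1) (by simp [sigma3])
    (tendsto_id.const_mul_atBot (by linarith)) hψ⟩

/-- Existence comes from ψ_{+,1} at -q₀²/z ∈ D⁻, uniqueness from decay. -/
lemma existsUnique_plus_one (hq : IsPotential q0 qm qp q) (hz : z ∈ DPlus q0) :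
    ∃! ψ, IsJostColumn q0 q atTop qp 1 z ψ := by
  have hq0 := hq.ofReal_q0_ne_zero
  have hz0 := ne_zero_of_mem_DPlus hz
  obtain ⟨ψ, hψ⟩ := hq.exists_isJostColumn_plus (inversion_mem_DMinus hq0 hz)
  have hψ' := hψ.inversion_zero hq0 (inversion_ne_zero hq0 hz0) hq.mul_conj_qp
  rw [inversion_inversion hq0 hz0] at hψ'
  have := im_lamOf_pos hz
  exact ⟨_, hψ', fun χ hχ => hχ.unique hq (s := -1) (by simp [sigma3])
    (tendsto_id.const_mul_atTop_of_neg (by linarith)) hψ'⟩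

lemma existsUnique_minus_zero (hq : IsPotential q0 qm qp q) (hz : z ∈ DPlus q0) :
    ∃! ψ, IsJostColumn q0 q atBot qm 0 z ψ := by
  have hq0 := hq.ofReal_q0_ne_zero
  have hz0 := ne_zero_of_mem_DPlus hz
  obtain ⟨ψ, hψ⟩ := hq.exists_isJostColumn_minus (inversion_mem_DMinus hq0 hz)
  have hψ' := hψ.inversion_one hq0 (inversion_ne_zero hq0 hz0) hq.mul_conj_qm
  rw [inversion_inversion hq0 hz0] at hψ'
  have := im_lamOf_pos hz
  exact ⟨_, hψ', fun χ hχ => hχ.unique hq (s := 1) (by simp [sigma3])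
    (tendsto_id.const_mul_atBot (by linarith)) hψ'⟩

lemma jostPlus_zero (hq : IsPotential q0 qm qp q) (hz : z ∈ DMinus q0) :
    IsJostColumn q0 q atTop qp 0 z (jostPlus q0 q qp 0 z) :=
  Classical.epsilon_spec (hq.existsUnique_plus_zero hz).exists

lemma jostMinus_one (hq : IsPotential q0 qm qp q) (hz : z ∈ DMinus q0) :
    IsJostColumn q0 q atBot qm 1 z (jostMinus q0 q qm 1 z) :=
  Classical.epsilon_spec (hq.existsUnique_minus_one hz).exists

lemma jostPlus_one (hq : IsPotential q0 qm qp q) (hz : z ∈ DPlus q0) :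
    IsJostColumn q0 q atTop qp 1 z (jostPlus q0 q qp 1 z) :=
  Classical.epsilon_spec (hq.existsUnique_plus_one hz).exists

lemma jostMinus_zero (hq : IsPotential q0 qm qp q) (hz : z ∈ DPlus q0) :
    IsJostColumn q0 q atBot qm 0 z (jostMinus q0 q qm 0 z) :=
  Classical.epsilon_spec (hq.existsUnique_minus_zero hz).exists

lemma jostPlus_one_conj (hq : IsPotential q0 qm qp q) (hz : z ∈ DMinus q0) :
    jostPlus q0 q qp 1 (conj z)
      = fun x t => ![-conj (jostPlus q0 q qp 0 z x t 1), conj (jostPlus q0 q qp 0 z x t 0)] :=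
  (hq.existsUnique_plus_one (conj_mem_DPlus hz)).unique (hq.jostPlus_one (conj_mem_DPlus hz))
    (hq.jostPlus_zero hz).conj_zero

lemma jostMinus_zero_conj (hq : IsPotential q0 qm qp q) (hz : z ∈ DMinus q0) :
    jostMinus q0 q qm 0 (conj z)
      = fun x t => ![conj (jostMinus q0 q qm 1 z x t 1), -conj (jostMinus q0 q qm 1 z x t 0)] :=
  (hq.existsUnique_minus_zero (conj_mem_DPlus hz)).unique (hq.jostMinus_zero (conj_mem_DPlus hz))
    (hq.jostMinus_one hz).conj_one

lemma jostPlus_one_inversion (hq : IsPotential q0 qm qp q) (hz : z ∈ DMinus q0) :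
    jostPlus q0 q qp 1 (-(q0 : ℂ) ^ 2 / z)
      = fun x t => (I * z / conj qp) • jostPlus q0 q qp 0 z x t :=
  have h := inversion_mem_DPlus hq.ofReal_q0_ne_zero hz
  (hq.existsUnique_plus_one h).unique (hq.jostPlus_one h)
    ((hq.jostPlus_zero hz).inversion_zero hq.ofReal_q0_ne_zero (ne_zero_of_mem_DMinus hz)
      hq.mul_conj_qp)

lemma jostMinus_zero_inversion (hq : IsPotential q0 qm qp q) (hz : z ∈ DMinus q0) :
    jostMinus q0 q qm 0 (-(q0 : ℂ) ^ 2 / z)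
      = fun x t => (I * z / qm) • jostMinus q0 q qm 1 z x t :=
  have h := inversion_mem_DPlus hq.ofReal_q0_ne_zero hz
  (hq.existsUnique_minus_zero h).unique (hq.jostMinus_zero h)
    ((hq.jostMinus_one hz).inversion_one hq.ofReal_q0_ne_zero (ne_zero_of_mem_DMinus hz)
      hq.mul_conj_qm)

lemma gam_ne_zero_of_mem_DMinus (hq : IsPotential q0 qm qp q) (hz : z ∈ DMinus q0) :
    gam q0 z ≠ 0 :=
  gam_ne_zero (ne_zero_of_mem_DMinus hz) hq.q0_pos (norm_ne_of_mem_DMinus hz)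

lemma gam_ne_zero_of_mem_DPlus (hq : IsPotential q0 qm qp q) (hz : z ∈ DPlus q0) :
    gam q0 z ≠ 0 :=
  gam_ne_zero (ne_zero_of_mem_DPlus hz) hq.q0_pos (norm_ne_of_mem_DPlus hz)

lemma wronskian_eq_s11 (hq : IsPotential q0 qm qp q) (hz : z ∈ DMinus q0) (x t : ℝ) :
    wronskian (jostPlus q0 q qp 0 z x t) (jostMinus q0 q qm 1 z x t)
      = gam q0 z * s11 q0 q qm qp z := by
  rw [s11, mul_div_cancel₀ _ (hq.gam_ne_zero_of_mem_DMinus hz),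
    (hq.jostPlus_zero hz).wronskian_eq (hq.jostMinus_one hz)]

lemma wronskian_eq_s22 (hq : IsPotential q0 qm qp q) (hz : z ∈ DPlus q0) (x t : ℝ) :
    wronskian (jostMinus q0 q qm 0 z x t) (jostPlus q0 q qp 1 z x t)
      = gam q0 z * s22 q0 q qm qp z := by
  rw [s22, mul_div_cancel₀ _ (hq.gam_ne_zero_of_mem_DPlus hz),
    (hq.jostMinus_zero hz).wronskian_eq (hq.jostPlus_one hz)]

lemma s22_conj (hq : IsPotential q0 qm qp q) (hz : z ∈ DMinus q0) :
    s22 q0 q qm qp (conj z) = conj (s11 q0 q qm qp z) := by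
  rw [s22, s11, hq.jostPlus_one_conj hz, hq.jostMinus_zero_conj hz, gam_conj]
  simp [wronskian]
  ring

/-- The two normalizing factors and the swap of arguments multiply the Wronskian by z²/(q₋q₊*),
while γ gains z²/q₀²; with q₀² = q₊q₊* the quotient is q₊/q₋. -/
lemma s22_inversion (hq : IsPotential q0 qm qp q) (hz : z ∈ DMinus q0) :
    s22 q0 q qm qp (-(q0 : ℂ) ^ 2 / z) = qp / qm * s11 q0 q qm qp z := by
  have hq0 := hq.ofReal_q0_ne_zero
  have hz0 := ne_zero_of_mem_DMinus hz
  have hm := hq.qm_ne_zero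
  have hp := hq.qp_ne_zero
  have hpc : conj qp ≠ 0 := (map_ne_zero _).2 hp
  have hg := hq.gam_ne_zero_of_mem_DMinus hz
  rw [s22, s11, hq.jostPlus_one_inversion hz, hq.jostMinus_zero_inversion hz,
    gam_inversion hq0 hz0, wronskian_smul_left, wronskian_smul_right, wronskian_comm,
    ← hq.mul_conj_qp]
  field_simp
  linear_combination (-(wronskian (jostPlus q0 q qp 0 z 0 0) (jostMinus q0 q qm 1 z 0 0)))
    * Complex.I_sq

lemma s11_conj (hq : IsPotential q0 qm qp q) (hz : z ∈ DPlus q0) :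
    s11 q0 q qm qp (conj z) = conj (s22 q0 q qm qp z) := by
  have := hq.s22_conj (conj_mem_DMinus hz)
  rw [conj_conj] at this
  rw [this, conj_conj]

lemma s22_eq_inversion (hq : IsPotential q0 qm qp q) (hz : z ∈ DPlus q0) :
    s22 q0 q qm qp z = qp / qm * s11 q0 q qm qp (-(q0 : ℂ) ^ 2 / z) := by
  have hq0 := hq.ofReal_q0_ne_zero
  have := hq.s22_inversion (inversion_mem_DMinus hq0 hz)
  rwa [inversion_inversion hq0 (ne_zero_of_mem_DPlus hz)] at this

lemma hasDerivAt_s22_conj (hq : IsPotential q0 qm qp q) (hz : z ∈ DMinus q0) {d : ℂ}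
    (h : HasDerivAt (s11 q0 q qm qp) d z) :
    HasDerivAt (s22 q0 q qm qp) (conj d) (conj z) := by
  refine h.conj_conj.congr_of_eventuallyEq ?_
  filter_upwards [(isOpen_DPlus q0).mem_nhds (conj_mem_DPlus hz)] with w hw
  simp [hq.s11_conj hw]

lemma hasDerivAt_s11_conj (hq : IsPotential q0 qm qp q) (hz : z ∈ DPlus q0) {d : ℂ}
    (h : HasDerivAt (s22 q0 q qm qp) d z) :
    HasDerivAt (s11 q0 q qm qp) (conj d) (conj z) := by
  refine h.conj_conj.congr_of_eventuallyEq ?_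
  filter_upwards [(isOpen_DMinus q0).mem_nhds (conj_mem_DMinus hz)] with w hw
  simp [hq.s22_conj hw]

/-- The relation between s₂₂ and s₁₁ holds on the open set D⁺, so the chain rule applies; z²/q₀² is
the derivative of w ↦ -q₀²/w at -q₀²/z. -/
lemma hasDerivAt_s22_inversion (hq : IsPotential q0 qm qp q) (hz : z ∈ DMinus q0) {d : ℂ}
    (h : HasDerivAt (s11 q0 q qm qp) d z) :
    HasDerivAt (s22 q0 q qm qp) (qp / qm * (d * (z ^ 2 / (q0 : ℂ) ^ 2)))
      (-(q0 : ℂ) ^ 2 / z) := by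
  have hq0 := hq.ofReal_q0_ne_zero
  have hz0 := ne_zero_of_mem_DMinus hz
  have hw0 := inversion_ne_zero hq0 hz0
  have h1 : HasDerivAt (fun w : ℂ => -(q0 : ℂ) ^ 2 / w) (z ^ 2 / (q0 : ℂ) ^ 2)
      (-(q0 : ℂ) ^ 2 / z) := by
    refine ((hasDerivAt_const _ (-(q0 : ℂ) ^ 2)).div (hasDerivAt_id _) hw0).congr_deriv ?_
    simp only [id]
    field_simp
    ring
  have h2 : HasDerivAt (s11 q0 q qm qp) d (-(q0 : ℂ) ^ 2 / (-(q0 : ℂ) ^ 2 / z)) := by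
    rwa [inversion_inversion hq0 hz0]
  refine ((h2.comp _ h1).const_mul (qp / qm)).congr_of_eventuallyEq ?_
  filter_upwards [(isOpen_DPlus q0).mem_nhds (inversion_mem_DPlus hq0 hz)] with w hw
  exact hq.s22_eq_inversion hw

lemma existsUnique_isBMinus (hq : IsPotential q0 qm qp q) (hz : z ∈ DMinus q0)
    (h : s11 q0 q qm qp z = 0) : ∃! b, IsBMinus q0 q qm qp z b := by
  have hψ := hq.jostPlus_zero hz
  have hχ := hq.jostMinus_one hz
  have hw := hq.wronskian_eq_s11 hz 0 0
  rw [h, mul_zero] at hw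
  obtain ⟨b, hb⟩ := exists_smul_of_wronskian_eq_zero (hχ.ne_zero hq 0 0) hw
  refine ⟨b, hψ.eq_smul_of_eq_zero hq hχ hb, fun c hc => ?_⟩
  exact smul_left_injective ℂ (hχ.ne_zero hq 0 0) ((hc 0 0).symm.trans hb)

lemma existsUnique_isBPlus (hq : IsPotential q0 qm qp q) (hz : z ∈ DPlus q0)
    (h : s22 q0 q qm qp z = 0) : ∃! b, IsBPlus q0 q qm qp z b := by
  have hψ := hq.jostPlus_one hz
  have hχ := hq.jostMinus_zero hz
  have hw := hq.wronskian_eq_s22 hz 0 0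
  rw [h, mul_zero, wronskian_comm, neg_eq_zero] at hw
  obtain ⟨b, hb⟩ := exists_smul_of_wronskian_eq_zero (hχ.ne_zero hq 0 0) hw
  refine ⟨b, hψ.eq_smul_of_eq_zero hq hχ hb, fun c hc => ?_⟩
  exact smul_left_injective ℂ (hχ.ne_zero hq 0 0) ((hc 0 0).symm.trans hb)

lemma isBMinus_bMinus (hq : IsPotential q0 qm qp q) (hz : z ∈ DMinus q0)
    (h : s11 q0 q qm qp z = 0) : IsBMinus q0 q qm qp z (bMinus q0 q qm qp z) :=
  Classical.epsilon_spec (hq.existsUnique_isBMinus hz h).exists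

lemma bPlus_eq (hq : IsPotential q0 qm qp q) (hz : z ∈ DPlus q0) (h : s22 q0 q qm qp z = 0) {b : ℂ}
    (hb : IsBPlus q0 q qm qp z b) : bPlus q0 q qm qp z = b :=
  (hq.existsUnique_isBPlus hz h).unique
    (Classical.epsilon_spec (hq.existsUnique_isBPlus hz h).exists) hb

lemma s22_conj_eq_zero (hq : IsPotential q0 qm qp q) (hz : z ∈ DMinus q0)
    (h : s11 q0 q qm qp z = 0) : s22 q0 q qm qp (conj z) = 0 := by
  rw [hq.s22_conj hz, h, map_zero]

lemma s22_inversion_eq_zero (hq : IsPotential q0 qm qp q) (hz : z ∈ DMinus q0)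
    (h : s11 q0 q qm qp z = 0) : s22 q0 q qm qp (-(q0 : ℂ) ^ 2 / z) = 0 := by
  rw [hq.s22_inversion hz, h, mul_zero]

lemma s11_conj_eq_zero (hq : IsPotential q0 qm qp q) (hz : z ∈ DPlus q0)
    (h : s22 q0 q qm qp z = 0) : s11 q0 q qm qp (conj z) = 0 := by
  rw [hq.s11_conj hz, h, map_zero]

/-- The minus sign arises because conjugation acts with opposite signs on the first and the second
column. -/
lemma bPlus_conj (hq : IsPotential q0 qm qp q) (hz : z ∈ DMinus q0) (h : s11 q0 q qm qp z = 0) :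
    bPlus q0 q qm qp (conj z) = -conj (bMinus q0 q qm qp z) := by
  refine hq.bPlus_eq (conj_mem_DPlus hz) (hq.s22_conj_eq_zero hz h) fun x t => ?_
  rw [hq.jostPlus_one_conj hz, hq.jostMinus_zero_conj hz]
  simp only [hq.isBMinus_bMinus hz h x t]
  ext i
  fin_cases i <;> simp

lemma bPlus_inversion (hq : IsPotential q0 qm qp q) (hz : z ∈ DMinus q0)
    (h : s11 q0 q qm qp z = 0) :
    bPlus q0 q qm qp (-(q0 : ℂ) ^ 2 / z) = qm / conj qp * bMinus q0 q qm qp z := by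
  refine hq.bPlus_eq (inversion_mem_DPlus hq.ofReal_q0_ne_zero hz) (hq.s22_inversion_eq_zero hz h)
    fun x t => ?_
  have hm := hq.qm_ne_zero
  rw [hq.jostPlus_one_inversion hz, hq.jostMinus_zero_inversion hz]
  simp only [hq.isBMinus_bMinus hz h x t, smul_smul]
  congr 1
  field_simp

lemma CMinus_eq_conj (hq : IsPotential q0 qm qp q) (hz : z ∈ DMinus q0)
    (h : s11 q0 q qm qp z = 0) (hd : DifferentiableAt ℂ (s11 q0 q qm qp) z) :
    CMinus q0 q qm qp z = -conj (CPlus q0 q qm qp (conj z)) := by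
  rw [CMinus, CPlus, (hq.hasDerivAt_s22_conj hz hd.hasDerivAt).deriv, hq.bPlus_conj hz h]
  simp [neg_div]

/-- The factor q₋/q₊* of b₊ is divided by the factor q₊z²/(q₋q₀²) of s₂₂', leaving q₋²/z². -/
lemma CMinus_eq_inversion (hq : IsPotential q0 qm qp q) (hz : z ∈ DMinus q0)
    (h : s11 q0 q qm qp z = 0) (hd : DifferentiableAt ℂ (s11 q0 q qm qp) z) :
    CMinus q0 q qm qp z = z ^ 2 / qm ^ 2 * CPlus q0 q qm qp (-(q0 : ℂ) ^ 2 / z) := by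
  have hz0 := ne_zero_of_mem_DMinus hz
  have hm := hq.qm_ne_zero
  have hp := hq.qp_ne_zero
  have hpc : conj qp ≠ 0 := (map_ne_zero _).2 hp
  rw [CMinus, CPlus, (hq.hasDerivAt_s22_inversion hz hd.hasDerivAt).deriv,
    hq.bPlus_inversion hz h, ← hq.mul_conj_qp]
  field_simp

end IsPotential

/-! ### Quartets of zeros and the theorem. -/

lemma im_inversion_conj (q0 : ℝ) (z : ℂ) :
    (-(q0 : ℂ) ^ 2 / conj z).im = -(q0 ^ 2 / Complex.normSq z) * z.im := by
  have : -(q0 : ℂ) ^ 2 / conj z = ((-q0 ^ 2 : ℝ) : ℂ) / conj z := by push_cast; rfl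
  rw [this, Complex.div_im]
  simp only [Complex.ofReal_re, Complex.ofReal_im, Complex.conj_im, Complex.normSq_conj]
  ring

lemma im_ne_zero_of_mem_DMinus {q0 : ℝ} {z : ℂ} (hz : z ∈ DMinus q0) : z.im ≠ 0 := by
  intro h; simp [DMinus, h] at hz

lemma notMem_contour_iff {q0 : ℝ} (hq0 : 0 < q0) {z : ℂ} :
    z ∉ contour q0 ↔ z ∈ DMinus q0 ∨ z ∈ DPlus q0 := by
  have h : ‖z‖ = q0 ↔ ‖z‖ ^ 2 - q0 ^ 2 = 0 := by
    rw [sub_eq_zero, pow_left_inj₀ (norm_nonneg z) hq0.le two_ne_zero]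
  simp only [contour, DMinus, DPlus, Set.mem_ofPred_eq]
  rw [h, or_comm, ← mul_eq_zero, ← ne_eq, ne_iff_lt_or_gt]

end KE

end

theorem mainTheorem4 (q0 : ℝ) (qm qp : ℂ) (q : ℝ → ℝ → ℂ) (hq : KE.IsPotential q0 qm qp q)
    (N : ℕ) (ζ : Fin N → ℂ) (hinj : Function.Injective ζ)
    (hzeros : Set.range ζ = {z | z ∈ KE.DMinus q0 ∧ z.im < 0 ∧ KE.s11 q0 q qm qp z = 0})
    (hsimple : ∀ n, deriv (KE.s11 q0 q qm qp) (ζ n) ≠ 0) :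
    -- the Jost columns exist, are unique, and have Wronskians independent of `x` and `t`
    (∀ z ∈ KE.DMinus q0,
      (∃! ψ, KE.IsJostColumn q0 q atTop qp 0 z ψ) ∧ (∃! ψ, KE.IsJostColumn q0 q atBot qm 1 z ψ) ∧
      ∀ x t, KE.wronskian (KE.jostPlus q0 q qp 0 z x t) (KE.jostMinus q0 q qm 1 z x t)
        = KE.gam q0 z * KE.s11 q0 q qm qp z) ∧
    (∀ z ∈ KE.DPlus q0,
      (∃! ψ, KE.IsJostColumn q0 q atTop qp 1 z ψ) ∧ (∃! ψ, KE.IsJostColumn q0 q atBot qm 0 z ψ) ∧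
      ∀ x t, KE.wronskian (KE.jostMinus q0 q qm 0 z x t) (KE.jostPlus q0 q qp 1 z x t)
        = KE.gam q0 z * KE.s22 q0 q qm qp z) ∧
    -- the discrete spectrum consists of the quartets
    (∀ t, KE.discreteSpectrum q0 q t = {w | ∃ n, w = ζ n ∨ w = -(q0 : ℂ) ^ 2 / conj (ζ n) ∨
      w = conj (ζ n) ∨ w = -(q0 : ℂ) ^ 2 / ζ n}) ∧
    -- its points in `D⁻` are the zeros of `s₁₁`, those in `D⁺` the zeros of `s₂₂`, all simple
    {z | z ∈ KE.DMinus q0 ∧ KE.s11 q0 q qm qp z = 0}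
      = {w | ∃ n, w = ζ n ∨ w = -(q0 : ℂ) ^ 2 / conj (ζ n)} ∧
    {z | z ∈ KE.DPlus q0 ∧ KE.s22 q0 q qm qp z = 0}
      = {w | ∃ n, w = conj (ζ n) ∨ w = -(q0 : ℂ) ^ 2 / ζ n} ∧
    (∀ z ∈ KE.DMinus q0, KE.s11 q0 q qm qp z = 0 → deriv (KE.s11 q0 q qm qp) z ≠ 0) ∧
    (∀ z ∈ KE.DPlus q0, KE.s22 q0 q qm qp z = 0 → deriv (KE.s22 q0 q qm qp) z ≠ 0) ∧
    -- the constants `b_±` are well defined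
    (∀ z ∈ KE.DMinus q0, KE.s11 q0 q qm qp z = 0 → ∃! b, KE.IsBMinus q0 q qm qp z b) ∧
    (∀ z ∈ KE.DPlus q0, KE.s22 q0 q qm qp z = 0 → ∃! b, KE.IsBPlus q0 q qm qp z b) ∧
    -- the norming constants at every point of the discrete spectrum in `D⁻`
    (∀ z ∈ KE.DMinus q0, KE.s11 q0 q qm qp z = 0 →
      KE.CMinus q0 q qm qp z = -conj (KE.CPlus q0 q qm qp (conj z)) ∧
      KE.CMinus q0 q qm qp z
        = z ^ 2 / qm ^ 2 * KE.CPlus q0 q qm qp (-(q0 : ℂ) ^ 2 / z) ∧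
      KE.CMinus q0 q qm qp z
        = -(z ^ 2 / qm ^ 2) * conj (KE.CMinus q0 q qm qp (-(q0 : ℂ) ^ 2 / conj z))) := by
  have hq0 := hq.ofReal_q0_ne_zero
  have hζ : ∀ n, ζ n ∈ KE.DMinus q0 ∧ (ζ n).im < 0 ∧ KE.s11 q0 q qm qp (ζ n) = 0 := fun n => by
    have : ζ n ∈ Set.range ζ := ⟨n, rfl⟩
    rwa [hzeros] at this
  have hinv : ∀ z ∈ KE.DMinus q0, KE.s11 q0 q qm qp z = 0 →
      -(q0 : ℂ) ^ 2 / conj z ∈ KE.DMinus q0 ∧ KE.s11 q0 q qm qp (-(q0 : ℂ) ^ 2 / conj z) = 0 :=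
    fun z hz h => by
      have h1 := KE.inversion_mem_DPlus hq0 hz
      have h2 := hq.s11_conj_eq_zero h1 (hq.s22_inversion_eq_zero hz h)
      have h3 := KE.conj_mem_DMinus h1
      rw [KE.conj_inversion] at h2 h3
      exact ⟨h3, h2⟩
  have hinvinv : ∀ z ∈ KE.DMinus q0, -(q0 : ℂ) ^ 2 / conj (-(q0 : ℂ) ^ 2 / conj z) = z :=
    fun z hz => by
      rw [KE.conj_inversion, conj_conj, KE.inversion_inversion hq0 (KE.ne_zero_of_mem_DMinus hz)]
  have hZm : {z | z ∈ KE.DMinus q0 ∧ KE.s11 q0 q qm qp z = 0}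
      = {w | ∃ n, w = ζ n ∨ w = -(q0 : ℂ) ^ 2 / conj (ζ n)} := by
    ext z
    constructor
    · rintro ⟨hz, h⟩
      have key : ∀ w ∈ KE.DMinus q0, w.im < 0 → KE.s11 q0 q qm qp w = 0 → ∃ n, ζ n = w :=
        fun w hw him hw0 => by
          have : w ∈ Set.range ζ := by rw [hzeros]; exact ⟨hw, him, hw0⟩
          exact this
      -- A zero of s₁₁ in the upper half-plane is sent by z ↦ -q₀²/z* to one in the lower
      -- half-plane, which is listed; the map is an involution.
      rcases lt_or_gt_of_ne (KE.im_ne_zero_of_mem_DMinus hz) with him | him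
      · obtain ⟨n, hn⟩ := key z hz him h
        exact ⟨n, Or.inl hn.symm⟩
      · obtain ⟨hw, hw0⟩ := hinv z hz h
        have hpos : 0 < q0 ^ 2 / Complex.normSq z :=
          div_pos (pow_pos hq.q0_pos 2) (Complex.normSq_pos.2 (KE.ne_zero_of_mem_DMinus hz))
        obtain ⟨n, hn⟩ := key _ hw (by rw [KE.im_inversion_conj]; nlinarith) hw0
        exact ⟨n, Or.inr (by rw [hn, hinvinv z hz])⟩
    · rintro ⟨n, rfl | rfl⟩
      · exact ⟨(hζ n).1, (hζ n).2.2⟩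
      · exact hinv _ (hζ n).1 (hζ n).2.2
  have hZp : {z | z ∈ KE.DPlus q0 ∧ KE.s22 q0 q qm qp z = 0}
      = {w | ∃ n, w = conj (ζ n) ∨ w = -(q0 : ℂ) ^ 2 / ζ n} := by
    ext z
    constructor
    · rintro ⟨hz, h⟩
      have : conj z ∈ {z | z ∈ KE.DMinus q0 ∧ KE.s11 q0 q qm qp z = 0} :=
        ⟨KE.conj_mem_DMinus hz, hq.s11_conj_eq_zero hz h⟩
      rw [hZm] at this
      obtain ⟨n, hn | hn⟩ := this
      · exact ⟨n, Or.inl (by rw [← hn, conj_conj])⟩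
      · exact ⟨n, Or.inr (by rw [← conj_conj z, hn, KE.conj_inversion, conj_conj])⟩
    · rintro ⟨n, rfl | rfl⟩
      · exact ⟨KE.conj_mem_DPlus (hζ n).1, hq.s22_conj_eq_zero (hζ n).1 (hζ n).2.2⟩
      · exact ⟨KE.inversion_mem_DPlus hq0 (hζ n).1, hq.s22_inversion_eq_zero (hζ n).1 (hζ n).2.2⟩
  have hdm : ∀ z ∈ KE.DMinus q0, KE.s11 q0 q qm qp z = 0 → deriv (KE.s11 q0 q qm qp) z ≠ 0 := by
    intro z hz h
    have : z ∈ {z | z ∈ KE.DMinus q0 ∧ KE.s11 q0 q qm qp z = 0} := ⟨hz, h⟩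
    rw [hZm] at this
    obtain ⟨n, rfl | rfl⟩ := this
    · exact hsimple n
    -- The derivative passes through s₂₂: first the inversion into D⁺, then conjugation back into
    -- D⁻. Differentiability at `ζ n` is implied by the non-zero value of `deriv`.
    · have h1 := hq.hasDerivAt_s22_inversion (hζ n).1
        (differentiableAt_of_deriv_ne_zero (hsimple n)).hasDerivAt
      have h2 := hq.hasDerivAt_s11_conj (KE.inversion_mem_DPlus hq0 (hζ n).1) h1
      rw [KE.conj_inversion] at h2
      rw [h2.deriv]
      have hz0 := KE.ne_zero_of_mem_DMinus (hζ n).1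
      exact (map_ne_zero _).2 (mul_ne_zero (div_ne_zero hq.qp_ne_zero hq.qm_ne_zero)
        (mul_ne_zero (hsimple n) (div_ne_zero (pow_ne_zero 2 hz0) (pow_ne_zero 2 hq0))))
  have hdp : ∀ z ∈ KE.DPlus q0, KE.s22 q0 q qm qp z = 0 → deriv (KE.s22 q0 q qm qp) z ≠ 0 := by
    intro z hz h
    have h1 := hdm _ (KE.conj_mem_DMinus hz) (hq.s11_conj_eq_zero hz h)
    have h2 := hq.hasDerivAt_s22_conj (KE.conj_mem_DMinus hz)
      (differentiableAt_of_deriv_ne_zero h1).hasDerivAt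
    rw [conj_conj] at h2
    rw [h2.deriv]
    exact (map_ne_zero _).2 h1
  refine ⟨fun z hz => ⟨hq.existsUnique_plus_zero hz, hq.existsUnique_minus_one hz,
      hq.wronskian_eq_s11 hz⟩,
    fun z hz => ⟨hq.existsUnique_plus_one hz, hq.existsUnique_minus_zero hz,
      hq.wronskian_eq_s22 hz⟩, fun t => ?_, hZm, hZp, hdm, hdp,
    fun z => hq.existsUnique_isBMinus, fun z => hq.existsUnique_isBPlus, fun z hz h => ?_⟩
  · have hspec : ∀ z, z ∈ KE.discreteSpectrum q0 q t ↔
        z ∈ {z | z ∈ KE.DMinus q0 ∧ KE.s11 q0 q qm qp z = 0} ∨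
        z ∈ {z | z ∈ KE.DPlus q0 ∧ KE.s22 q0 q qm qp z = 0} := fun z => by
      rw [KE.discreteSpectrum, Set.mem_ofPred_eq, KE.notMem_contour_iff hq.q0_pos, or_and_right]
      refine or_congr (and_congr_right fun hz => ?_) (and_congr_right fun hz => ?_)
      · have := KE.im_lamOf_neg hz
        rw [KE.exists_memLp_iff_wronskian_eq_zero hq (hq.jostPlus_zero hz) (hq.jostMinus_one hz)
          (s := 1) (s' := -1) (by simp [KE.sigma3]) (by simp [KE.sigma3]) (by linarith)
          (by linarith), hq.wronskian_eq_s11 hz, mul_eq_zero,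
          or_iff_right (hq.gam_ne_zero_of_mem_DMinus hz)]
      · have := KE.im_lamOf_pos hz
        rw [KE.exists_memLp_iff_wronskian_eq_zero hq (hq.jostPlus_one hz) (hq.jostMinus_zero hz)
          (s := -1) (s' := 1) (by simp [KE.sigma3]) (by simp [KE.sigma3]) (by linarith)
          (by linarith), KE.wronskian_comm, neg_eq_zero, hq.wronskian_eq_s22 hz, mul_eq_zero,
          or_iff_right (hq.gam_ne_zero_of_mem_DPlus hz)]
    ext z
    rw [hspec, hZm, hZp]
    simp only [Set.mem_ofPred_eq, ← exists_or, or_assoc]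
  · have hd : ∀ z ∈ KE.DMinus q0, KE.s11 q0 q qm qp z = 0 →
        DifferentiableAt ℂ (KE.s11 q0 q qm qp) z := fun z hz h =>
      differentiableAt_of_deriv_ne_zero (hdm z hz h)
    have h2 := hq.CMinus_eq_inversion hz h (hd z hz h)
    refine ⟨hq.CMinus_eq_conj hz h (hd z hz h), h2, ?_⟩
    obtain ⟨hw, hw0⟩ := hinv z hz h
    -- The conjugation identity at -q₀²/z*, whose conjugate is -q₀²/z, combines with the inversion
    -- identity at z.
    have h3 := hq.CMinus_eq_conj hw hw0 (hd _ hw hw0)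
    rw [KE.conj_inversion, conj_conj] at h3
    rw [h3, h2, map_neg, conj_conj]
    ring
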